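/- **Definitions.** For probability measures $U,V$ on a common measurable space, the trade-off function is $T(U,V)(\alpha)=\inf\{1-\mathbb E_V[\phi] : \phi \text{ measurable},\ 0\le\phi\le 1,\ \mathbb E_U[\phi]\le\alpha\}$, $\alpha\in[0,1]$, and $G_\mu=T(N(0,1),N(\mu,1))$, i.e. $G_\mu(\alpha)=\Phi(\Phi^{-1}(1-\alpha)-\mu)$. A mechanism $M$ is $\mu$-GDP if $T(M(X_0),M(X_1))\ge G_\mu$ on $[0,1]$ for all neighbouring datasets $X_0,X_1$ (datasets of the same size that differ in exactly one record). Let $\mathcal D$ be a set and $\mathcal S^{(1)},\dots,\mathcal S^{(n)}$ measurable spaces. An $\epsilon_0$-LDP adaptive process is a sequence of randomizers $\mathcal R^{(i)}:\mathcal S^{(1)}\times\cdots\times\mathcal S^{(i-1)}\times\mathcal D\to\mathcal S^{(i)}$, $i=1,\dots,n$ (for each record, a Markov kernel in the previous outputs) such that $\mathbb P(\mathcal R^{(i)}(z_{1:i-1},x)\in E)\le e^{\epsilon_0}\,\mathbb P(\mathcal R^{(i)}(z_{1:i-1},x')\in E)$ for all $i$, $z_{1:i-1}$, $x,x'\in\mathcal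 D$ and measurable $E$. The shuffled process $\mathcal A_{R,S}$ takes a dataset $x_{1:n}\in\mathcal D^n$, draws a uniformly random permutation $\pi$ of $\{1,\dots,n\}$, computes successively $z_i=\mathcal R^{(i)}(z_{1:i-1},x_{\pi(i)})$, and outputs $z_{1:n}$. **Theorem 2.** Let $\epsilon_0>0$, $p=e^{-\epsilon_0}$ and $\mu_n=\dfrac{2e^{\epsilon_0/2}}{\sqrt{n-1}}$ for $n\ge 2$. 1. As $n\to\infty$, the shuffled $\epsilon_0$-LDP adaptive process is asymptotically $\mu_n$-GDP, with an error that is negligible compared with $\mu_n$: there is a sequence $\delta_n=o(\mu_n)=o(n^{-1/2})$, depending only on $\epsilon_0$, such that for every $n\ge2$, every domain $\mathcal D$, every $\epsilon_0$-LDP adaptive process of length $n$ on $\mathcal D$, all neighbouring datasets $X_0,X_1\in\mathcal D^n$ and all $\alpha\in[0,1]$, $$T\big(\mathcal A_{R,S}(X_0),\mathcal A_{R,S}(X_1)\big)(\alpha)\ \ge\ G_{\mu_n}(\alpha)-\delta_n .$$ 2. For every $n\ge2$ let $\boldsymbol\mu_0=\big(\tfrac{(n-1)p}{2}+1,\tfrac{(n-1)p}{2}\big)'$,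 $\boldsymbol\mu_1=\big(\tfrac{(n-1)p}{2},\tfrac{(n-1)p}{2}+1\big)'$ and $\boldsymbol\Sigma=(n-1)\begin{pmatrix}\frac p2(1-\frac p2)&-\frac{p^2}{4}\\-\frac{p^2}{4}&\frac p2(1-\frac p2)\end{pmatrix}$, which are the means of $(n_0+1,n_1)$ and $(n_0,n_1+1)$ and their common covariance matrix for $(n_0,n_1,n_2)$ multinomial with parameters $(n-1;\frac p2,\frac p2,1-p)$. Then the Mahalanobis distance $\sqrt{(\boldsymbol\mu_1-\boldsymbol\mu_0)'\boldsymbol\Sigma^{-1}(\boldsymbol\mu_1-\boldsymbol\mu_0)}$ equals $\dfrac{2}{\sqrt{(n-1)p}}=\mu_n$, and $T\big(N(\boldsymbol\mu_0,\boldsymbol\Sigma),N(\boldsymbol\mu_1,\boldsymbol\Sigma)\big)=G_{\mu_n}$ on $[0,1]$. -/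

import Mathlib

universe u v w

open MeasureTheory ProbabilityTheory

noncomputable section

namespace ShuffleDP

/-! ### Trade-off functions and Gaussian differential privacy -/

/-- The trade-off function `T(U, V)`: the least type II error `1 - E_V[φ]` over all measurable
randomized rejection rules `0 ≤ φ ≤ 1` whose type I error `E_U[φ]` is at most `α`. -/
def tradeoff {Ω : Type w} [MeasurableSpace Ω] (U V : Measure Ω) (α : ℝ) : ℝ :=
  sInf {β : ℝ | ∃ φ : Ω → ℝ, Measurable φ ∧ (∀ ω, φ ω ∈ Set.Icc (0 : ℝ) 1) ∧
    ∫ ω, φ ω ∂U ≤ α ∧ β = 1 - ∫ ω, φ ω ∂V}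

/-- The Gaussian trade-off function `G_μ = T(N(0,1), N(μ,1))`. -/
def gaussianTradeoff (μ α : ℝ) : ℝ :=
  tradeoff (gaussianReal 0 1) (gaussianReal μ 1) α

/-- Two datasets of the same size are neighbouring if they differ in exactly one record. -/
def Neighbouring {D : Type u} {n : ℕ} (X₀ X₁ : Fin n → D) : Prop :=
  ∃ i, X₀ i ≠ X₁ i ∧ ∀ j, j ≠ i → X₀ j = X₁ j

/-- A mechanism `M` (dataset to law of the output) is `μ`-GDP up to the additive error `δ`:
its trade-off functions on neighbouring datasets are at least `G_μ - δ` on `[0, 1]`.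
For `δ = 0` this is `μ`-GDP. -/
def IsGDPUpTo {D : Type u} {n : ℕ} {Ω : Type w} [MeasurableSpace Ω]
    (M : (Fin n → D) → Measure Ω) (μ δ : ℝ) : Prop :=
  ∀ X₀ X₁ : Fin n → D, Neighbouring X₀ X₁ → ∀ α ∈ Set.Icc (0 : ℝ) 1,
    gaussianTradeoff μ α - δ ≤ tradeoff (M X₀) (M X₁) α

/-! ### Adaptive processes -/

/-- A randomizer on single records is `ε`-LDP. -/
def IsLDP {D : Type u} {Ω : Type w} [MeasurableSpace Ω] (ε : ℝ) (M : D → Measure Ω) : Prop :=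
  ∀ x x' : D, ∀ E : Set Ω, MeasurableSet E → M x E ≤ ENNReal.ofReal (Real.exp ε) * M x' E

section Adaptive

variable {D : Type u} {S : ℕ → Type v} [∀ i, MeasurableSpace (S i)]

/-- Appending the next output `z_k` to the outputs `z_0, …, z_{k-1}`. -/
def append (k : ℕ) (q : ((j : Fin k) → S j) × S k) : (j : Fin (k + 1)) → S j :=
  Fin.snoc (α := fun j : Fin (k + 1) => S j) q.1 q.2

theorem measurable_append (k : ℕ) : Measurable (append (S := S) k) := by
  refine measurable_pi_iff.mpr fun j => ?_
  refine Fin.lastCases ?_ (fun i => ?_) j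
  · have h : (fun q : ((j : Fin k) → S j) × S k => append k q (Fin.last k)) = fun q => q.2 := by
      funext q
      exact Fin.snoc_last (α := fun j : Fin (k + 1) => S j) q.2 q.1
    rw [h]
    exact measurable_snd
  · have h : (fun q : ((j : Fin k) → S j) × S k => append k q i.castSucc) = fun q => q.1 i := by
      funext q
      exact Fin.snoc_castSucc (α := fun j : Fin (k + 1) => S j) q.2 q.1 i
    rw [h]
    exact (measurable_pi_apply i).comp measurable_fst

/-- The law of the outputs `z_{1:k}` of the adaptive process on the dataset `x_{1:k}`:
successively `z_i` is drawn from `R i x_i z_{1:i-1}`. Indices start at `0`. -/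
def adaptiveLaw (R : (i : ℕ) → D → Kernel ((j : Fin i) → S j) (S i)) :
    (k : ℕ) → (Fin k → D) → Measure ((j : Fin k) → S j)
  | 0, _ => Measure.dirac (fun j => j.elim0)
  | k + 1, x =>
    ((adaptiveLaw R k (Fin.init x)) ⊗ₘ (R k (x (Fin.last k)))).map (append k)

/-- The law of the shuffled adaptive process: a permutation `π` of the `n` records is drawn
uniformly, and then the adaptive process is run on `x_{π 1}, …, x_{π n}`. -/
def shuffledLaw (R : (i : ℕ) → D → Kernel ((j : Fin i) → S j) (S i)) (n : ℕ)
    (X : Fin n → D) : Measure ((j : Fin n) → S j) :=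
  ((Nat.factorial n : ENNReal)⁻¹) • ∑ π : Equiv.Perm (Fin n), adaptiveLaw R n (fun i => X (π i))

/-- The first `n` steps of the process are `ε`-LDP, for all values of the previous outputs. -/
def IsLDPProcess (ε : ℝ) (n : ℕ)
    (R : (i : ℕ) → D → Kernel ((j : Fin i) → S j) (S i)) : Prop :=
  ∀ i < n, ∀ z : (j : Fin i) → S j, IsLDP ε (fun x => R i x z)

end Adaptive

/-! ### The parameter and the bivariate Gaussians -/

/-- `μ_n = 2 e^{ε/2} / √(n - 1)`. -/
def gdpParam (ε : ℝ) (n : ℕ) : ℝ := 2 * Real.exp (ε / 2) / Real.sqrt ((n : ℝ) - 1)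

/-- The mean of `(n₀ + 1, n₁)` for `(n₀, n₁, n₂)` multinomial with parameters
`(n - 1; p/2, p/2, 1 - p)`. -/
def mean₀ (p : ℝ) (n : ℕ) : EuclideanSpace ℝ (Fin 2) :=
  !₂[((n : ℝ) - 1) * p / 2 + 1, ((n : ℝ) - 1) * p / 2]

/-- The mean of `(n₀, n₁ + 1)`. -/
def mean₁ (p : ℝ) (n : ℕ) : EuclideanSpace ℝ (Fin 2) :=
  !₂[((n : ℝ) - 1) * p / 2, ((n : ℝ) - 1) * p / 2 + 1]

/-- The covariance matrix of `(n₀, n₁)`. -/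
def covMat (p : ℝ) (n : ℕ) : Matrix (Fin 2) (Fin 2) ℝ :=
  ((n : ℝ) - 1) • !![p / 2 * (1 - p / 2), -(p ^ 2 / 4); -(p ^ 2 / 4), p / 2 * (1 - p / 2)]

/-- The Mahalanobis distance `√((y - x)ᵀ Σ⁻¹ (y - x))`. -/
def mahalanobis (Sig : Matrix (Fin 2) (Fin 2) ℝ) (x y : EuclideanSpace ℝ (Fin 2)) : ℝ :=
  Real.sqrt ((y - x).ofLp ⬝ᵥ (Sig⁻¹.mulVec (y - x).ofLp))

end ShuffleDP

end

/-!
A record `x` is *cloned* with probability `p = e^{-ε}`: by the LDP condition, `R x` is a mixture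
`(1 - p) η_x + (p/2) R x₀ + (p/2) R x₁`, where `x₀` and `x₁` are the two values of the record `i` in
which the neighbouring datasets differ. Labelling the components of this mixture by `0`, `-1`, `1`,
the shuffled output becomes a function of random labels: the label of `i` is `-1` for one dataset
and `1` for the other one, and the other labels are independent. After shuffling, the output does
not distinguish `i` from the other cloned records. Hence a test `φ` becomes a function `g` of the
labels that is invariant under exchanging `i` with a cloned record.

For a uniform label `l i = ±1`, the power and the size of `g` are `E[(1 + l i) g]` and
`E[(1 - l i) g]`, and by exchangeability `l i` may be replaced by the mean label of the cloned
records. Up to `O(1/n)` in `L¹`, that mean is `(μ/2) W`, where `W` is the sum of the other labels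
divided by `√((n-1) p)` and `μ = 2/√((n-1) p)`. Therefore power minus size is `μ E[g W]` up to
`O(1/n)`, and `E[g W] ≤ t E[g] + E[(W - t)⁺]` for every threshold `t`. By the central limit theorem
`E[(W - t)⁺]` converges to its value for a standard Gaussian, and for a suitable `t` the bound then
agrees with the power of the Gaussian threshold test of the same size up to `o(μ)`. Finitely many
`t` suffice for all sizes up to `η μ`, so the error is uniform.

For Gaussians with common covariance `S` and means differing by `μ S w` with `wᵀ S w = 1`, the
projection `z ↦ wᵀ z` maps them to `N(c, 1)` and `N(c + μ, 1)`. Conversely, since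
`S - (S w)(S w)ᵀ` is positive semidefinite, they arise from `N(0, 1)` and `N(μ, 1)` by embedding the
line in the direction `S w` and adding an independent noise. Both operations can only increase the
trade-off function.
-/

noncomputable section

namespace ShuffleDP

/-! ### Tests and trade-off functions -/

section Tradeoff

variable {Ω : Type*} [MeasurableSpace Ω] {U V : Measure Ω} {φ : Ω → ℝ} {α : ℝ}

/-- A randomized test: `φ ω` is the probability of rejecting the null hypothesis when `ω` is
observed. -/
structure IsTest (φ : Ω → ℝ) : Prop where
  measurable : Measurable φ
  mem_Icc : ∀ ω, φ ω ∈ Set.Icc (0 : ℝ) 1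

theorem IsTest.integrable [IsFiniteMeasure U] (hφ : IsTest φ) : Integrable φ U :=
  Integrable.of_mem_Icc 0 1 hφ.measurable.aemeasurable (.of_forall hφ.mem_Icc)

theorem IsTest.integral_mem_Icc [IsProbabilityMeasure U] (hφ : IsTest φ) :
    ∫ ω, φ ω ∂U ∈ Set.Icc (0 : ℝ) 1 :=
  (convex_Icc 0 1).integral_mem isClosed_Icc (.of_forall hφ.mem_Icc) hφ.integrable

theorem tradeoff_le [IsProbabilityMeasure V] (hφ : IsTest φ) (hα : ∫ ω, φ ω ∂U ≤ α) :
    tradeoff U V α ≤ 1 - ∫ ω, φ ω ∂V := by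
  refine csInf_le ⟨0, ?_⟩ ⟨φ, hφ.measurable, hφ.mem_Icc, hα, rfl⟩
  rintro _ ⟨ψ, hψ, hψ01, -, rfl⟩
  linarith [((IsTest.mk hψ hψ01).integral_mem_Icc (U := V)).2]

theorem le_tradeoff {c : ℝ} (hα : 0 ≤ α)
    (h : ∀ φ : Ω → ℝ, IsTest φ → ∫ ω, φ ω ∂U ≤ α → c ≤ 1 - ∫ ω, φ ω ∂V) :
    c ≤ tradeoff U V α := by
  refine le_csInf ⟨_, fun _ => 0, measurable_const, by simp, by simpa using hα, rfl⟩ ?_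
  rintro _ ⟨φ, hφ, hφ01, hle, rfl⟩
  exact h φ ⟨hφ, hφ01⟩ hle

theorem tradeoff_antitone [IsProbabilityMeasure V] {α' : ℝ} (hα : 0 ≤ α) (h : α ≤ α') :
    tradeoff U V α' ≤ tradeoff U V α :=
  le_tradeoff hα fun _ hφ hle => tradeoff_le hφ (hle.trans h)

theorem tradeoff_le_one_sub [IsProbabilityMeasure U] [IsProbabilityMeasure V]
    (hα : α ∈ Set.Icc (0 : ℝ) 1) : tradeoff U V α ≤ 1 - α := by
  simpa using tradeoff_le (U := U) (V := V) (φ := fun _ => α) ⟨measurable_const, fun _ => hα⟩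
    (by simp)

theorem tradeoff_self [IsProbabilityMeasure U] (hα : α ∈ Set.Icc (0 : ℝ) 1) :
    tradeoff U U α = 1 - α :=
  (tradeoff_le_one_sub hα).antisymm (le_tradeoff hα.1 fun _ _ hle => by linarith)

theorem tradeoff_le_tradeoff_map {Ω' : Type*} [MeasurableSpace Ω'] [IsProbabilityMeasure V]
    {f : Ω → Ω'} (hf : Measurable f) (hα : 0 ≤ α) :
    tradeoff U V α ≤ tradeoff (U.map f) (V.map f) α := by
  refine le_tradeoff hα fun φ hφ hle => ?_
  rw [integral_map hf.aemeasurable hφ.measurable.aestronglyMeasurable] at hle ⊢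
  exact tradeoff_le ⟨hφ.measurable.comp hf, fun ω => hφ.mem_Icc _⟩ hle

theorem tradeoff_le_tradeoff_prod {Ω' : Type*} [MeasurableSpace Ω'] [IsProbabilityMeasure U]
    [IsProbabilityMeasure V] (N : Measure Ω') [IsProbabilityMeasure N] (hα : 0 ≤ α) :
    tradeoff U V α ≤ tradeoff (U.prod N) (V.prod N) α := by
  refine le_tradeoff hα fun φ hφ hle => ?_
  have hsection : ∀ x, IsTest fun y => φ (x, y) := fun x =>
    ⟨hφ.measurable.comp measurable_prodMk_left, fun y => hφ.mem_Icc _⟩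
  rw [integral_prod _ hφ.integrable] at hle ⊢
  exact tradeoff_le ⟨hφ.measurable.stronglyMeasurable.integral_prod_right'.measurable,
    fun x => (hsection x).integral_mem_Icc⟩ hle

end Tradeoff

/-! ### Mixtures of adaptive processes -/

section Mixture

theorem compProd_eq_sum {α β ι ι' : Type*} [MeasurableSpace α] [MeasurableSpace β] [Fintype ι]
    [Fintype ι'] {μ : Measure α} [SFinite μ] {ν : ι → Measure α} [∀ i, SFinite (ν i)]
    {κ : Kernel α β} [IsSFiniteKernel κ] {η : ι' → Kernel α β} [∀ s, IsSFiniteKernel (η s)]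
    {c : ι → ENNReal} {d : ι' → ENNReal} (hμ : μ = ∑ i, c i • ν i)
    (hκ : ∀ a, κ a = ∑ s, d s • η s a) :
    μ ⊗ₘ κ = ∑ i, ∑ s, (c i * d s) • (ν i ⊗ₘ η s) := by
  ext E hE
  have hη : ∀ s, Measurable fun a => η s a (Prod.mk a ⁻¹' E) := fun s =>
    Kernel.measurable_kernel_prodMk_left hE
  simp only [Measure.compProd_apply hE, Measure.finsetSum_apply, Measure.smul_apply, smul_eq_mul,
    hκ]
  rw [hμ, lintegral_finsetSum_measure]
  refine Finset.sum_congr rfl fun i _ => ?_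
  rw [lintegral_smul_measure, lintegral_finsetSum _ fun s _ => (hη s).const_mul _, smul_eq_mul,
    Finset.mul_sum]
  exact Finset.sum_congr rfl fun s _ => by rw [lintegral_const_mul _ (hη s), mul_assoc]

theorem exists_isMarkovKernel_eq_smul_add {α β : Type*} [MeasurableSpace α] [MeasurableSpace β]
    (κ : Kernel α β) [IsMarkovKernel κ] {ν : α → Measure β} (hν : Measurable ν)
    (hle : ∀ a, ν a ≤ κ a) {c : ENNReal} (hc : c < 1) (hmass : ∀ a, ν a Set.univ = c) :
    ∃ η : Kernel α β, IsMarkovKernel η ∧ ∀ a, κ a = (1 - c) • η a + ν a := by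
  have hd0 : 1 - c ≠ 0 := (tsub_pos_of_lt hc).ne'
  have hdt : 1 - c ≠ ⊤ := ENNReal.sub_ne_top ENNReal.one_ne_top
  have hfin : ∀ a, IsFiniteMeasure (ν a) := fun a => ⟨by rw [hmass]; exact hc.trans_le le_top⟩
  have hη : Measurable fun a => (1 - c)⁻¹ • (κ a - ν a) := by
    refine Measure.measurable_of_measurable_coe _ fun E hE => ?_
    simp only [Measure.smul_apply, Measure.sub_apply hE (hle _), smul_eq_mul]
    exact ((κ.measurable_coe hE).sub ((Measure.measurable_coe hE).comp hν)).const_mul _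
  refine ⟨⟨_, hη⟩, ⟨fun a => ⟨?_⟩⟩, fun a => ?_⟩
  · change ((1 - c)⁻¹ • (κ a - ν a)) Set.univ = 1
    rw [Measure.smul_apply, Measure.sub_apply .univ (hle a), measure_univ, hmass]
    exact ENNReal.inv_mul_cancel hd0 hdt
  · change κ a = (1 - c) • ((1 - c)⁻¹ • (κ a - ν a)) + ν a
    rw [smul_smul, ENNReal.mul_inv_cancel hd0 hdt, one_smul, Measure.sub_add_cancel_of_le (hle a)]

variable {D : Type u} {D' : Type*} {S : ℕ → Type v} [∀ i, MeasurableSpace (S i)]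
  (R : (i : ℕ) → D → Kernel ((j : Fin i) → S j) (S i))

theorem shuffledLaw_comp_perm {n : ℕ} (σ : Equiv.Perm (Fin n)) (X : Fin n → D) :
    shuffledLaw R n (X ∘ σ) = shuffledLaw R n X :=
  congrArg (_ • ·) (Equiv.sum_comp (Equiv.mulLeft σ) fun π => adaptiveLaw R n fun i => X (π i))

variable [∀ i x, IsMarkovKernel (R i x)]
  (K : (i : ℕ) → D' → Kernel ((j : Fin i) → S j) (S i)) [∀ i x, IsMarkovKernel (K i x)]

instance isProbabilityMeasure_adaptiveLaw (k : ℕ) (x : Fin k → D) :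
    IsProbabilityMeasure (adaptiveLaw R k x) := by
  induction k with
  | zero => rw [adaptiveLaw]; infer_instance
  | succ k ih =>
    rw [adaptiveLaw]
    exact Measure.isProbabilityMeasure_map (measurable_append k).aemeasurable

instance isProbabilityMeasure_shuffledLaw (n : ℕ) (X : Fin n → D) :
    IsProbabilityMeasure (shuffledLaw R n X) := by
  constructor
  simp only [shuffledLaw, Measure.smul_apply, Measure.finsetSum_apply, measure_univ,
    Finset.sum_const, Finset.card_univ, Fintype.card_perm, Fintype.card_fin, nsmul_eq_mul, mul_one,
    smul_eq_mul]
  exact ENNReal.inv_mul_cancel (by exact_mod_cast n.factorial_ne_zero) (ENNReal.natCast_ne_top _)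

variable {ι : Type*} [Fintype ι]

theorem adaptiveLaw_eq_sum {k : ℕ} {x : Fin k → D} {y : Fin k → ι → D'} {c : Fin k → ι → ENNReal}
    (h : ∀ (i : Fin k) (z : (j : Fin (i : ℕ)) → S j), R i (x i) z = ∑ s, c i s • K i (y i s) z) :
    adaptiveLaw R k x =
      ∑ l : Fin k → ι, (∏ i, c i (l i)) • adaptiveLaw K k (fun i => y i (l i)) := by
  induction k with
  | zero => simp [adaptiveLaw]
  | succ k ih =>
    have hinit := ih (x := fun i => x i.castSucc) (y := fun i => y i.castSucc)
      (c := fun i => c i.castSucc) fun i z => h i.castSucc z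
    have hstep : ∀ z, R k (x (Fin.last k)) z =
        ∑ s, c (Fin.last k) s • K k (y (Fin.last k) s) z := h (Fin.last k)
    have hsnoc : ∀ (l : Fin k → ι) (s : ι) (i : Fin k),
        (Fin.snocEquiv fun _ => ι) (s, l) i.castSucc = l i := by simp [Fin.snocEquiv]
    have hlast : ∀ (l : Fin k → ι) (s : ι),
        (Fin.snocEquiv fun _ => ι) (s, l) (Fin.last k) = s := by simp [Fin.snocEquiv]
    rw [← (Fin.snocEquiv fun _ => ι).sum_comp, Fintype.sum_prod_type_right]
    simp only [adaptiveLaw, Fin.prod_univ_castSucc, hsnoc, hlast, Fin.init_def]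
    rw [compProd_eq_sum hinit hstep,
      Measure.map_finset_sum' (measurable_append k).aemeasurable]
    refine Finset.sum_congr rfl fun l _ => ?_
    rw [Measure.map_finset_sum' (measurable_append k).aemeasurable]
    exact Finset.sum_congr rfl fun s _ => Measure.map_smul _ _ _

theorem shuffledLaw_eq_sum {n : ℕ} {X : Fin n → D} {y : Fin n → ι → D'} {c : Fin n → ι → ENNReal}
    (h : ∀ k < n, ∀ (j : Fin n) (z : (j : Fin k) → S j),
      R k (X j) z = ∑ s, c j s • K k (y j s) z) :
    shuffledLaw R n X =
      ∑ l : Fin n → ι, (∏ j, c j (l j)) • shuffledLaw K n (fun j => y j (l j)) := by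
  have hperm : ∀ π : Equiv.Perm (Fin n), adaptiveLaw R n (fun i => X (π i)) =
      ∑ l : Fin n → ι, (∏ j, c j (l j)) • adaptiveLaw K n (fun i => y (π i) (l (π i))) := by
    intro π
    rw [adaptiveLaw_eq_sum R K fun i z => h i i.2 (π i) z,
      ← (Equiv.arrowCongr π.symm (Equiv.refl ι)).sum_comp]
    refine Finset.sum_congr rfl fun l _ => ?_
    rw [← Equiv.prod_comp π fun j => c j (l j)]
    rfl
  simp only [shuffledLaw, hperm, smul_comm _ ((Nat.factorial n : ENNReal)⁻¹)]
  rw [Finset.sum_comm, ← Finset.smul_sum]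
  simp only [Finset.smul_sum]

theorem shuffledLaw_congr {n : ℕ} {X Y : Fin n → D} (h : ∀ k < n, ∀ j, R k (X j) = R k (Y j)) :
    shuffledLaw R n X = shuffledLaw R n Y := by
  simpa using shuffledLaw_eq_sum R R (y := fun j (_ : Unit) => Y j) (c := fun _ _ => 1)
    fun k hk j z => by simp [h k hk j]

end Mixture

/-! ### Random labels -/

instance : MeasurableSpace SignType := ⊤

instance : DiscreteMeasurableSpace SignType := ⟨fun _ => trivial⟩

/-- The law of a label: a record is cloned with probability `q`, and then gets one of the labels
`-1` and `1`, each with probability `q / 2`; otherwise its label is `0`. -/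
def labelLaw (q : unitInterval) : Measure SignType :=
  ENNReal.ofReal (1 - q) • Measure.dirac 0 +
    (ENNReal.ofReal (q / 2) • Measure.dirac (-1) + ENNReal.ofReal (q / 2) • Measure.dirac 1)

/-- The law of `n` independent labels, if the label of the record `i` has law `ν` and the other
records are cloned with probability `p`. -/
def labelsLaw {n : ℕ} (p : unitInterval) (i : Fin n) (ν : Measure SignType) :
    Measure (Fin n → SignType) :=
  Measure.pi (Function.update (fun _ => labelLaw p) i ν)

/-- A function of the labels which does not change if the label of the record `i` is exchanged with
the label of another cloned record. -/
def SwapInvariant {n : ℕ} (i : Fin n) (g : (Fin n → SignType) → ℝ) : Prop :=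
  ∀ l j, l i ≠ 0 → l j ≠ 0 → g (l ∘ Equiv.swap i j) = g l

section Labels

theorem sum_signType {M : Type*} [AddCommMonoid M] (f : SignType → M) :
    ∑ s, f s = f 0 + (f (-1) + f 1) := by
  have huniv : (Finset.univ : Finset SignType) = {0, -1, 1} := rfl
  rw [huniv, Finset.sum_insert (by decide), Finset.sum_insert (by decide), Finset.sum_singleton]

theorem labelLaw_real_singleton (q : unitInterval) (s : SignType) :
    (labelLaw q).real {s} = if s = 0 then 1 - (q : ℝ) else q / 2 := by
  have hq : 0 ≤ (q : ℝ) / 2 := div_nonneg q.2.1 zero_le_two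
  have hq' : 0 ≤ 1 - (q : ℝ) := sub_nonneg.2 q.2.2
  cases s <;> simp [labelLaw, Measure.real, hq, hq', SignType.zero_eq_zero]

theorem labelLaw_singleton (q : unitInterval) (s : SignType) :
    labelLaw q {s} = ENNReal.ofReal (if s = 0 then 1 - (q : ℝ) else q / 2) := by
  cases s <;> simp [labelLaw]

instance isProbabilityMeasure_labelLaw (q : unitInterval) : IsProbabilityMeasure (labelLaw q) := by
  constructor
  have hq : 0 ≤ (q : ℝ) / 2 := div_nonneg q.2.1 zero_le_two
  simp only [labelLaw, Measure.add_apply, Measure.smul_apply, measure_univ, smul_eq_mul, mul_one]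
  rw [← ENNReal.ofReal_add hq hq, add_halves, ← ENNReal.ofReal_add (sub_nonneg.2 q.2.2) q.2.1,
    sub_add_cancel, ENNReal.ofReal_one]

theorem integral_labelLaw (q : unitInterval) (f : SignType → ℝ) :
    ∫ s, f s ∂labelLaw q = (1 - q) * f 0 + (q / 2 * f (-1) + q / 2 * f 1) := by
  rw [integral_fintype .of_finite, sum_signType]
  simp [labelLaw_real_singleton]

instance isProbabilityMeasure_update {ι Ω : Type*} [DecidableEq ι] [MeasurableSpace Ω]
    (μ : ι → Measure Ω) [∀ j, IsProbabilityMeasure (μ j)] (i : ι) (ν : Measure Ω)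
    [IsProbabilityMeasure ν] (j : ι) : IsProbabilityMeasure (Function.update μ i ν j) := by
  rw [Function.update_apply]
  split_ifs <;> infer_instance

variable {n : ℕ} (p : unitInterval) (i : Fin n) (ν : Measure SignType)

instance isProbabilityMeasure_labelsLaw [IsProbabilityMeasure ν] :
    IsProbabilityMeasure (labelsLaw p i ν) := by
  unfold labelsLaw; infer_instance

theorem labelsLaw_singleton [IsProbabilityMeasure ν] (l : Fin n → SignType) :
    labelsLaw p i ν {l} = ∏ j, (Function.update (fun _ => labelLaw p) i ν j) {l j} :=
  Measure.pi_singleton _ l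

theorem labelsLaw_real_singleton [IsProbabilityMeasure ν] (l : Fin n → SignType) :
    (labelsLaw p i ν).real {l} =
      ν.real {l i} * ∏ j ∈ Finset.univ.erase i, (labelLaw p).real {l j} := by
  rw [Measure.real, labelsLaw_singleton, ENNReal.toReal_prod,
    ← Finset.mul_prod_erase _ _ (Finset.mem_univ i), Function.update_self]
  refine congrArg _ (Finset.prod_congr rfl fun j hj => ?_)
  rw [Function.update_of_ne (Finset.ne_of_mem_erase hj), Measure.real]

theorem integral_labelsLaw_eq_integral_mul {ν ν' : Measure SignType} [IsProbabilityMeasure ν]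
    [IsProbabilityMeasure ν'] {f : SignType → ℝ} (h : ∀ s, ν.real {s} = f s * ν'.real {s})
    (g : (Fin n → SignType) → ℝ) :
    ∫ l, g l ∂labelsLaw p i ν = ∫ l, f (l i) * g l ∂labelsLaw p i ν' := by
  rw [integral_fintype .of_finite, integral_fintype .of_finite]
  refine Finset.sum_congr rfl fun l _ => ?_
  rw [labelsLaw_real_singleton, labelsLaw_real_singleton, h]
  simp only [smul_eq_mul]
  ring

theorem integral_labelsLaw_dirac {b : SignType} (hb : b ≠ 0) (g : (Fin n → SignType) → ℝ) :
    ∫ l, g l ∂labelsLaw p i (Measure.dirac b) =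
      ∫ l, (1 + (b : ℝ) * (l i : ℝ)) * g l ∂labelsLaw p i (labelLaw 1) :=
  integral_labelsLaw_eq_integral_mul p i (f := fun s => 1 + (b : ℝ) * (s : ℝ)) (fun s => by
    rw [labelLaw_real_singleton]
    cases b <;> cases s <;> simp_all [Measure.real] <;> norm_num) g

end Labels

/-! ### Reduction to labels -/

section Reduction

variable {D : Type u} {S : ℕ → Type v} [∀ i, MeasurableSpace (S i)] {p : unitInterval} {n : ℕ}

theorem shuffledLaw_comp_swap {K : (k : ℕ) → SignType × D → Kernel ((j : Fin k) → S j) (S k)}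
    [∀ k q, IsMarkovKernel (K k q)] (hclone : ∀ k, ∀ s ≠ 0, ∀ x x', K k (s, x) = K k (s, x'))
    (X : Fin n → D) {i j : Fin n} {l : Fin n → SignType} (hi : l i ≠ 0) (hj : l j ≠ 0) :
    shuffledLaw K n (fun m => (l (Equiv.swap i j m), X m)) =
      shuffledLaw K n fun m => (l m, X m) := by
  refine (shuffledLaw_congr K fun k _ m => ?_).trans
    (shuffledLaw_comp_perm K (Equiv.swap i j) fun m => (l m, X m))
  by_cases hm : m = i ∨ m = j
  · exact hclone k _ (by rcases hm with rfl | rfl <;> simpa) _ _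
  · push Not at hm
    simp [Equiv.swap_apply_of_ne_of_ne hm.1 hm.2]

variable {R : (i : ℕ) → D → Kernel ((j : Fin i) → S j) (S i)} [∀ i x, IsMarkovKernel (R i x)]

theorem exists_eq_sum_labelLaw_smul {α β : Type*} [MeasurableSpace α] [MeasurableSpace β]
    (hp : p < 1) (κ κ₀ κ₁ : Kernel α β) [IsMarkovKernel κ] [IsMarkovKernel κ₀] [IsMarkovKernel κ₁]
    (h₀ : ∀ a, ENNReal.ofReal p • κ₀ a ≤ κ a) (h₁ : ∀ a, ENNReal.ofReal p • κ₁ a ≤ κ a) :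
    ∃ η : Kernel α β, IsMarkovKernel η ∧
      ∀ a, κ a = labelLaw p {0} • η a + (labelLaw p {-1} • κ₀ a + labelLaw p {1} • κ₁ a) := by
  set c := ENNReal.ofReal ((p : ℝ) / 2)
  have hc : c + c = ENNReal.ofReal p := by
    rw [← ENNReal.ofReal_add (div_nonneg p.2.1 zero_le_two) (div_nonneg p.2.1 zero_le_two),
      add_halves]
  have hmeas : Measurable fun a => c • κ₀ a + c • κ₁ a := by
    refine Measure.measurable_of_measurable_coe _ fun E hE => ?_
    exact ((κ₀.measurable_coe hE).const_mul c).add ((κ₁.measurable_coe hE).const_mul c)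
  have hle : ∀ a, c • κ₀ a + c • κ₁ a ≤ κ a := fun a => by
    refine Measure.le_iff'.2 fun E => ?_
    have h2 : (2 : ENNReal) ≠ 0 := two_ne_zero
    rw [← ENNReal.mul_le_mul_iff_right h2 (by simp)]
    calc 2 * (c * κ₀ a E + c * κ₁ a E) = (c + c) * κ₀ a E + (c + c) * κ₁ a E := by ring
      _ ≤ κ a E + κ a E := by rw [hc]; exact add_le_add (h₀ a E) (h₁ a E)
      _ = 2 * κ a E := by ring
  have hlt : ENNReal.ofReal p < 1 := ENNReal.ofReal_lt_one.2 hp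
  obtain ⟨η, hη, h⟩ := exists_isMarkovKernel_eq_smul_add κ hmeas hle hlt fun a => by simp [hc]
  refine ⟨η, hη, fun a => ?_⟩
  have hzero : labelLaw p {0} = 1 - ENNReal.ofReal p := by
    rw [labelLaw_singleton, if_pos rfl, ENNReal.ofReal_sub _ p.2.1, ENNReal.ofReal_one]
  rw [h a, hzero, labelLaw_singleton, labelLaw_singleton, if_neg (by decide), if_neg (by decide)]

theorem exists_clonedKernel (hp : p < 1)
    (hR : ∀ k < n, ∀ z x x', ENNReal.ofReal p • R k x z ≤ R k x' z) (y : SignType → D) :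
    ∃ K : (k : ℕ) → SignType × D → Kernel ((j : Fin k) → S j) (S k),
      (∀ k q, IsMarkovKernel (K k q)) ∧ (∀ k, ∀ s ≠ 0, ∀ x, K k (s, x) = R k (y s)) ∧
      ∀ k < n, ∀ x z, R k x z = ∑ s, labelLaw p {s} • K k (s, x) z := by
  have hres : ∀ (k : ℕ) (x : D), ∃ η : Kernel ((j : Fin k) → S j) (S k), IsMarkovKernel η ∧
      (k < n → ∀ z, R k x z = labelLaw p {0} • η z +
        (labelLaw p {-1} • R k (y (-1)) z + labelLaw p {1} • R k (y 1) z)) := by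
    intro k x
    by_cases hk : k < n
    · obtain ⟨η, hη, h⟩ := exists_eq_sum_labelLaw_smul hp (R k x) (R k (y (-1))) (R k (y 1))
        (fun a => hR k hk a _ _) (fun a => hR k hk a _ _)
      exact ⟨η, hη, fun _ => h⟩
    · exact ⟨R k x, inferInstance, fun h => absurd h hk⟩
  choose η hη hmix using hres
  refine ⟨fun k q => if q.1 = 0 then η k q.2 else R k (y q.1), fun k q => ?_,
    fun k s hs x => if_neg hs, fun k hk x z => ?_⟩
  · dsimp only
    split_ifs <;> infer_instance
  · rw [hmix k x hk z, sum_signType]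
    simp

theorem shuffledLaw_update_eq_sum {K : (k : ℕ) → SignType × D → Kernel ((j : Fin k) → S j) (S k)}
    [∀ k q, IsMarkovKernel (K k q)] {y : SignType → D}
    (hclone : ∀ k, ∀ s ≠ 0, ∀ x, K k (s, x) = R k (y s)) (X : Fin n → D) (i : Fin n)
    (hmix : ∀ k < n, ∀ x z, R k x z = ∑ s, labelLaw p {s} • K k (s, x) z)
    {b : SignType} (hb : b ≠ 0) :
    shuffledLaw R n (Function.update X i (y b)) =
      ∑ l, labelsLaw p i (Measure.dirac b) {l} • shuffledLaw K n fun j => (l j, X j) := by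
  simp only [labelsLaw_singleton]
  refine shuffledLaw_eq_sum R K (y := fun j s => (s, X j))
    (c := fun j s => (Function.update (fun _ => labelLaw p) i (Measure.dirac b) j) {s})
    fun k hk j z => ?_
  obtain rfl | hj := eq_or_ne j i
  · rw [Function.update_self, Function.update_self, Finset.sum_eq_single b]
    · simp [hclone k b hb]
    · intro s _ hs
      simp [hs.symm]
    · simp
  · rw [Function.update_of_ne hj, Function.update_of_ne hj]
    exact hmix k hk (X j) z

theorem exists_isTest_labels (hp : p < 1)
    (hR : ∀ k < n, ∀ z x x', ENNReal.ofReal p • R k x z ≤ R k x' z)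
    (X : Fin n → D) (i : Fin n) (y : SignType → D)
    {φ : ((j : Fin n) → S j) → ℝ} (hφ : IsTest φ) :
    ∃ g : (Fin n → SignType) → ℝ, IsTest g ∧ SwapInvariant i g ∧
      ∀ b ≠ 0, ∫ z, φ z ∂shuffledLaw R n (Function.update X i (y b)) =
        ∫ l, g l ∂labelsLaw p i (Measure.dirac b) := by
  obtain ⟨K, hK, hclone, hmix⟩ := exists_clonedKernel hp hR y
  refine ⟨fun l => ∫ z, φ z ∂shuffledLaw K n fun j => (l j, X j),
    ⟨.of_discrete, fun l => hφ.integral_mem_Icc⟩,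
    fun l j hi hj => ?_, fun b hb => ?_⟩
  · simp only [Function.comp_apply]
    rw [shuffledLaw_comp_swap (fun k s hs x x' => by rw [hclone k s hs, hclone k s hs]) X hi hj]
  · rw [shuffledLaw_update_eq_sum hclone X i hmix hb,
      integral_finsetSum_measure fun l _ => hφ.integrable.smul_measure (measure_ne_top _ _),
      integral_fintype .of_finite]
    simp only [integral_smul_measure, Measure.real, smul_eq_mul]

end Reduction

/-! ### Exchangeability of the cloned records -/

section Exchange

/-- The sum of the labels: the number of clones labelled `1` minus that of clones labelled `-1`. -/
def labelSum {n : ℕ} (l : Fin n → SignType) : ℝ := ∑ j, (l j : ℝ)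

/-- The number of cloned records. -/
def cloneCount {n : ℕ} (l : Fin n → SignType) : ℝ := ∑ j, (l j : ℝ) ^ 2

variable {n : ℕ} {p : unitInterval} {i : Fin n}

theorem sq_signType_eq_one {s : SignType} (hs : s ≠ 0) : (s : ℝ) ^ 2 = 1 := by
  cases s <;> simp_all

theorem abs_signType_le_one (s : SignType) : |(s : ℝ)| ≤ 1 := by
  cases s <;> simp

theorem abs_labelSum_le_cloneCount (l : Fin n → SignType) : |labelSum l| ≤ cloneCount l :=
  (Finset.abs_sum_le_sum_abs _ _).trans <| Finset.sum_le_sum fun j _ => by cases l j <;> simp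

theorem cloneCount_pos {l : Fin n → SignType} (hi : l i ≠ 0) : 0 < cloneCount l :=
  Finset.sum_pos' (fun j _ => sq_nonneg _)
    ⟨i, Finset.mem_univ i, by rw [sq_signType_eq_one hi]; exact one_pos⟩

theorem cloneCount_comp_perm (σ : Equiv.Perm (Fin n)) (l : Fin n → SignType) :
    cloneCount (l ∘ σ) = cloneCount l :=
  Equiv.sum_comp σ fun k => (l k : ℝ) ^ 2

theorem ae_label_ne_zero : ∀ᵐ l ∂labelsLaw p i (labelLaw 1), l i ≠ 0 := by
  refine ae_iff_of_countable.2 fun l hl hi => hl ?_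
  rw [← measureReal_eq_zero_iff, labelsLaw_real_singleton, labelLaw_real_singleton, if_pos hi]
  simp

theorem mul_labelsLaw_real_singleton {l : Fin n → SignType} (hi : l i ≠ 0) :
    p * (labelsLaw p i (labelLaw 1)).real {l} = ∏ j, (labelLaw p).real {l j} := by
  rw [labelsLaw_real_singleton, ← Finset.mul_prod_erase _ _ (Finset.mem_univ i), ← mul_assoc,
    labelLaw_real_singleton, labelLaw_real_singleton, if_neg hi, if_neg hi]
  simp [div_eq_mul_inv]

theorem labelsLaw_real_singleton_comp_swap (hp : 0 < p) {l : Fin n → SignType} {j : Fin n}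
    (hi : l i ≠ 0) (hj : l j ≠ 0) :
    (labelsLaw p i (labelLaw 1)).real {l ∘ Equiv.swap i j} =
      (labelsLaw p i (labelLaw 1)).real {l} := by
  have hp' : (p : ℝ) ≠ 0 := (unitInterval.coe_pos.2 hp).ne'
  refine mul_left_cancel₀ hp' ?_
  rw [mul_labelsLaw_real_singleton hi, mul_labelsLaw_real_singleton (by simpa using hj)]
  exact Equiv.prod_comp (Equiv.swap i j) fun k => (labelLaw p).real {l k}

theorem integral_comp_swap (hp : 0 < p) {j : Fin n} {h : (Fin n → SignType) → ℝ}
    (hi : ∀ l, l i = 0 → h l = 0) (hj : ∀ l, l j = 0 → h l = 0) :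
    ∫ l, h (l ∘ Equiv.swap i j) ∂labelsLaw p i (labelLaw 1) =
      ∫ l, h l ∂labelsLaw p i (labelLaw 1) := by
  rw [integral_fintype .of_finite, integral_fintype .of_finite,
    ← ((Equiv.swap i j).arrowCongr (Equiv.refl SignType)).sum_comp]
  refine Finset.sum_congr rfl fun l _ => ?_
  have hl : (Equiv.swap i j).arrowCongr (Equiv.refl SignType) l = l ∘ Equiv.swap i j := by
    ext k; simp [Equiv.arrowCongr]
  have hll : (l ∘ Equiv.swap i j) ∘ Equiv.swap i j = l := by ext; simp
  rw [hl, hll]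
  by_cases hi' : l i = 0
  · simp [hi l hi']
  by_cases hj' : l j = 0
  · simp [hj l hj']
  · rw [labelsLaw_real_singleton_comp_swap hp hi' hj']

theorem integral_label_mul (hp : 0 < p) {g : (Fin n → SignType) → ℝ} (hg : SwapInvariant i g) :
    ∫ l, (l i : ℝ) * g l ∂labelsLaw p i (labelLaw 1) =
      ∫ l, g l * (labelSum l / cloneCount l) ∂labelsLaw p i (labelLaw 1) := by
  have hswap : ∀ j, ∫ l, (l i : ℝ) * (l j : ℝ) ^ 2 * (g l / cloneCount l)
      ∂labelsLaw p i (labelLaw 1) =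
        ∫ l, (l j : ℝ) * (g l / cloneCount l) ∂labelsLaw p i (labelLaw 1) := by
    intro j
    rw [← integral_comp_swap hp (j := j) (fun l hl => by simp [hl]) (fun l hl => by simp [hl])]
    refine integral_congr_ae (ae_label_ne_zero.mono fun l hi => ?_)
    by_cases hj : l j = 0
    · simp [hj]
    · simp [hg l j hi hj, cloneCount_comp_perm, sq_signType_eq_one hi]
  calc ∫ l, (l i : ℝ) * g l ∂labelsLaw p i (labelLaw 1)
      = ∫ l, ∑ j, (l i : ℝ) * (l j : ℝ) ^ 2 * (g l / cloneCount l)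
          ∂labelsLaw p i (labelLaw 1) := by
        refine integral_congr_ae (ae_label_ne_zero.mono fun l hi => ?_)
        have hm := (cloneCount_pos hi).ne'
        simp only [← Finset.sum_mul, ← Finset.mul_sum]
        change _ = (l i : ℝ) * cloneCount l * (g l / cloneCount l)
        field_simp
    _ = ∫ l, ∑ j, (l j : ℝ) * (g l / cloneCount l) ∂labelsLaw p i (labelLaw 1) := by
        rw [integral_finsetSum _ fun _ _ => .of_finite, integral_finsetSum _ fun _ _ => .of_finite]
        exact Finset.sum_congr rfl fun j _ => hswap j
    _ = ∫ l, g l * (labelSum l / cloneCount l) ∂labelsLaw p i (labelLaw 1) := by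
        simp only [← Finset.sum_mul, labelSum]
        congr with l
        ring

end Exchange

/-! ### Moments of the labels -/

section Moments

theorem integral_sq_sum_pi_sub {ι Ω : Type*} [Fintype ι] [MeasurableSpace Ω] {ν : Measure Ω}
    [IsProbabilityMeasure ν] {f : Ω → ℝ} (hf : MemLp f 2 ν) :
    ∫ ω, (∑ j, f (ω j) - Fintype.card ι * ∫ x, f x ∂ν) ^ 2 ∂Measure.pi (fun _ : ι => ν) =
      Fintype.card ι * Var[f; ν] := by
  have hmem : ∀ j : ι, MemLp (fun ω : ι → Ω => f (ω j)) 2 (Measure.pi fun _ => ν) := fun j =>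
    hf.comp_measurePreserving (measurePreserving_eval _ j)
  have hmean : ∫ ω, (∑ j, fun ω : ι → Ω => f (ω j)) ω ∂Measure.pi (fun _ : ι => ν) =
      Fintype.card ι * ∫ x, f x ∂ν := by
    simp only [Finset.sum_apply]
    rw [integral_finsetSum _ fun j _ => (hmem j).integrable one_le_two]
    simp [integral_comp_eval (μ := fun _ : ι => ν) hf.aestronglyMeasurable]
  have hvar := variance_sum_pi (μ := fun _ : ι => ν) (X := fun _ => f) fun _ => hf
  rw [variance_eq_integral (memLp_finsetSum' _ fun j _ => hmem j).aemeasurable, hmean] at hvar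
  simpa using hvar

theorem integral_removeNth_labelsLaw {N : ℕ} (p : unitInterval) (i : Fin (N + 1))
    (ν : Measure SignType) [IsProbabilityMeasure ν] (f : (Fin N → SignType) → ℝ) :
    ∫ l, f (i.removeNth l) ∂labelsLaw p i ν = ∫ ω, f ω ∂Measure.pi fun _ : Fin N => labelLaw p := by
  have h := measurePreserving_snd.comp (measurePreserving_piFinSuccAbove
    (Function.update (fun _ => labelLaw p) i ν) i)
  simp only [Function.update_of_ne (Fin.succAbove_ne _ _)] at h
  rw [← h.map_eq, integral_map .of_discrete .of_discrete]
  rfl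

theorem integral_labelSum_sq (N : ℕ) (p : unitInterval) :
    ∫ ω, labelSum ω ^ 2 ∂Measure.pi (fun _ : Fin N => labelLaw p) = N * p := by
  have h := integral_sq_sum_pi_sub (ι := Fin N) (ν := labelLaw p) (f := fun s => (s : ℝ))
    .of_discrete
  have hmean : ∫ s, (s : ℝ) ∂labelLaw p = 0 := by rw [integral_labelLaw]; simp
  rw [variance_eq_integral .of_discrete, hmean, integral_labelLaw] at h
  simpa [labelSum] using h

theorem integral_cloneCount_sub_sq (N : ℕ) (p : unitInterval) :
    ∫ ω, (cloneCount ω - N * p) ^ 2 ∂Measure.pi (fun _ : Fin N => labelLaw p) =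
      N * (p * (1 - p)) := by
  have h := integral_sq_sum_pi_sub (ι := Fin N) (ν := labelLaw p) (f := fun s => (s : ℝ) ^ 2)
    .of_discrete
  have hmean : ∫ s, (s : ℝ) ^ 2 ∂labelLaw p = p := by rw [integral_labelLaw]; simp
  rw [variance_eq_integral .of_discrete, hmean, integral_labelLaw, Fintype.card_fin] at h
  refine h.trans (congrArg _ ?_)
  simp only [SignType.coe_zero, SignType.coe_one, SignType.coe_neg]
  ring

theorem labelSum_eq_add {N : ℕ} (i : Fin (N + 1)) (l : Fin (N + 1) → SignType) :
    labelSum l = l i + labelSum (i.removeNth l) :=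
  Fin.sum_univ_succAbove _ i

theorem cloneCount_eq_add {N : ℕ} (i : Fin (N + 1)) (l : Fin (N + 1) → SignType) :
    cloneCount l = (l i : ℝ) ^ 2 + cloneCount (i.removeNth l) :=
  Fin.sum_univ_succAbove _ i

theorem abs_div_sub_div_le {S m A : ℝ} (hS : |S| ≤ m) (hA : 0 < A) :
    |S / m - S / A| ≤ (S ^ 2 / 2 + 3 / 2 * (m - A) ^ 2) / A ^ 2 := by
  have hquot : |S / m| ≤ 1 := by
    rw [abs_div]
    exact div_le_one_of_le₀ (hS.trans (le_abs_self m)) (abs_nonneg m)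
  have hexpand : S / m - S / A = (S * (A - m) + S / m * (A - m) ^ 2) / A ^ 2 := by
    rcases eq_or_ne m 0 with rfl | hm
    · simp [abs_nonpos_iff.1 hS]
    · field_simp
      ring
  have hcross : |S * (A - m)| ≤ S ^ 2 / 2 + (A - m) ^ 2 / 2 :=
    abs_le.2 ⟨by nlinarith [sq_nonneg (S + (A - m))], by nlinarith [sq_nonneg (S - (A - m))]⟩
  have hsquare : |S / m * (A - m) ^ 2| ≤ (A - m) ^ 2 := by
    rw [abs_mul, abs_sq]
    exact mul_le_of_le_one_left (sq_nonneg _) hquot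
  rw [hexpand, abs_div, abs_sq]
  gcongr
  linarith [abs_add_le (S * (A - m)) (S / m * (A - m) ^ 2), sub_sq_comm m A]

theorem abs_labelSum_div_cloneCount_sub_le {N : ℕ} {A : ℝ} (hA : 0 < A) (i : Fin (N + 1))
    (l : Fin (N + 1) → SignType) :
    |labelSum l / cloneCount l - labelSum (i.removeNth l) / A| ≤
      (labelSum (i.removeNth l) ^ 2 + 3 * (cloneCount (i.removeNth l) - A) ^ 2 + 4) / A ^ 2
        + 1 / A := by
  have hli := abs_signType_le_one (l i)
  have hli' : (l i : ℝ) ^ 2 ≤ 1 := (sq_le_one_iff_abs_le_one _).2 hli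
  have hlast : |labelSum l / A - labelSum (i.removeNth l) / A| ≤ 1 / A := by
    rw [labelSum_eq_add i, ← sub_div, add_sub_cancel_right, abs_div, abs_of_pos hA]
    gcongr
  refine (abs_sub_le _ (labelSum l / A) _).trans (add_le_add ?_ hlast)
  refine (abs_div_sub_div_le (abs_labelSum_le_cloneCount l) hA).trans ?_
  rw [labelSum_eq_add i l, cloneCount_eq_add i l]
  refine div_le_div_of_nonneg_right ?_ (sq_nonneg A)
  generalize labelSum (i.removeNth l) = S, cloneCount (i.removeNth l) = m
  nlinarith [sq_nonneg ((l i : ℝ) - S), sq_nonneg ((l i : ℝ) ^ 2 - (m - A)),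
    sq_nonneg (l i : ℝ)]

theorem integral_abs_labelSum_div_cloneCount_sub_le {N : ℕ} {p : unitInterval}
    (hA : 0 < (N : ℝ) * p) (i : Fin (N + 1)) :
    ∫ l, |labelSum l / cloneCount l - labelSum (i.removeNth l) / (N * p)|
      ∂labelsLaw p i (labelLaw 1) ≤ 5 / (N * p) + 4 / (N * p) ^ 2 := by
  calc _ ≤ ∫ l, ((labelSum (i.removeNth l) ^ 2 + 3 * (cloneCount (i.removeNth l) - N * p) ^ 2 + 4)
          / (N * p) ^ 2 + 1 / (N * p)) ∂labelsLaw p i (labelLaw 1) :=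
        integral_mono .of_finite .of_finite fun l => abs_labelSum_div_cloneCount_sub_le hA i l
    _ = ∫ ω, ((labelSum ω ^ 2 + 3 * (cloneCount ω - N * p) ^ 2 + 4) / (N * p) ^ 2 + 1 / (N * p))
          ∂Measure.pi fun _ : Fin N => labelLaw p :=
        integral_removeNth_labelsLaw p i (labelLaw 1) fun ω =>
          (labelSum ω ^ 2 + 3 * (cloneCount ω - N * p) ^ 2 + 4) / (N * p) ^ 2 + 1 / (N * p)
    _ = (N * p + 3 * (N * (p * (1 - p))) + 4) / (N * p) ^ 2 + 1 / (N * p) := by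
        rw [integral_add .of_finite .of_finite, integral_div,
          integral_add .of_finite .of_finite, integral_add .of_finite .of_finite,
          integral_const_mul, integral_labelSum_sq, integral_cloneCount_sub_sq]
        simp
    _ ≤ (N * p + 3 * (N * p) + 4) / (N * p) ^ 2 + 1 / (N * p) := by
        gcongr
        exact mul_le_of_le_one_right p.2.1 (sub_le_self 1 p.2.1)
    _ = 5 / (N * p) + 4 / (N * p) ^ 2 := by
        field_simp
        ring

theorem abs_integral_label_mul_sub_le {N : ℕ} {p : unitInterval} (hA : 0 < (N : ℝ) * p)
    {i : Fin (N + 1)} {g : (Fin (N + 1) → SignType) → ℝ} (hg : SwapInvariant i g)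
    (hg01 : IsTest g) :
    |∫ l, (l i : ℝ) * g l ∂labelsLaw p i (labelLaw 1) -
      ∫ l, g l * (labelSum (i.removeNth l) / (N * p)) ∂labelsLaw p i (labelLaw 1)| ≤
      5 / (N * p) + 4 / (N * p) ^ 2 := by
  have hp : 0 < p := unitInterval.coe_pos.1 (pos_of_mul_pos_right hA N.cast_nonneg)
  rw [integral_label_mul hp hg, ← integral_sub .of_finite .of_finite]
  refine abs_integral_le_integral_abs.trans (le_trans ?_
    (integral_abs_labelSum_div_cloneCount_sub_le hA i))
  refine integral_mono .of_finite .of_finite fun l => ?_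
  simp only [← mul_sub, abs_mul, abs_of_nonneg (hg01.mem_Icc l).1]
  exact mul_le_of_le_one_left (abs_nonneg _) (hg01.mem_Icc l).2

end Moments

/-! ### The central limit theorem for the labels -/

section CentralLimit

theorem tendstoInDistribution_inv_sqrt_mul_sum_pi {Ω : Type*} [MeasurableSpace Ω] {ν : Measure Ω}
    [IsProbabilityMeasure ν] {f : Ω → ℝ} (hf : Measurable f) (h0 : ν[f] = 0) (h1 : ν[f ^ 2] = 1) :
    TendstoInDistribution (fun (N : ℕ) (ω : Fin N → Ω) => (√N)⁻¹ * ∑ j, f (ω j)) Filter.atTop id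
      (fun N => Measure.pi fun _ : Fin N => ν) (gaussianReal 0 1) where
  forall_aemeasurable N := (show Measurable _ by fun_prop).aemeasurable
  aemeasurable_limit := aemeasurable_id
  tendsto := by
    have hchar : ∀ (N : ℕ) (t : ℝ),
        charFun ((Measure.pi fun _ : Fin N => ν).map fun ω => (√N)⁻¹ * ∑ j, f (ω j)) t =
          charFun (ν.map f) ((√N)⁻¹ * t) ^ N := fun N t => by
      have hindep := iIndepFun_pi (μ := fun _ : Fin N => ν) (X := fun _ => f) fun _ =>
        hf.aemeasurable
      rw [charFun_map_mul_comp (show Measurable _ by fun_prop).aemeasurable,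
        hindep.charFun_map_fun_sum_eq_prod fun j => (show Measurable _ by fun_prop).aemeasurable]
      have heval : ∀ j : Fin N, (Measure.pi fun _ : Fin N => ν).map (fun ω => f (ω j)) =
          ν.map f := fun j => (Measure.map_map hf (measurable_pi_apply j)).symm.trans
        (congrArg (Measure.map f) (measurePreserving_eval (fun _ : Fin N => ν) j).map_eq)
      simp [heval]
    refine ProbabilityMeasure.tendsto_iff_tendsto_charFun.2 fun t => ?_
    simpa [hchar, charFun_gaussianReal, neg_div] using
      tendsto_charFun_inv_sqrt_mul_pow hf.aemeasurable h0 h1 t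

theorem max_zero_le_min_add_sq_div {x M : ℝ} (hM : 0 < M) :
    max x 0 ≤ min (max x 0) M + x ^ 2 / M := by
  rcases le_total (max x 0) M with h | h
  · rw [min_eq_left h]
    exact le_add_of_nonneg_right (by positivity)
  · have hx : M ≤ x := (le_max_iff.1 h).resolve_right hM.not_ge
    rw [min_eq_right h, max_eq_left (hM.le.trans hx)]
    have : x ≤ x ^ 2 / M := by
      rw [le_div_iff₀ hM]
      nlinarith
    linarith

theorem eventually_integral_max_zero_le_add {ι Ω' : Type*} {Ω : ι → Type*}
    [∀ k, MeasurableSpace (Ω k)] [MeasurableSpace Ω'] {μ : (k : ι) → Measure (Ω k)}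
    [∀ k, IsProbabilityMeasure (μ k)] {μ' : Measure Ω'} [IsProbabilityMeasure μ']
    {X : (k : ι) → Ω k → ℝ} {Z : Ω' → ℝ} {l : Filter ι} (h : TendstoInDistribution X l Z μ μ')
    (hX : ∀ k, MemLp (X k) 2 (μ k)) {C : ℝ} (hC : ∀ k, ∫ ω, X k ω ^ 2 ∂μ k ≤ C)
    (hZ : Integrable Z μ') {η : ℝ} (hη : 0 < η) :
    ∀ᶠ k in l, ∫ ω, max (X k ω) 0 ∂μ k ≤ ∫ ω, max (Z ω) 0 ∂μ' + η := by
  obtain ⟨M, hM, hCM⟩ : ∃ M > 0, C / M < η := by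
    refine ⟨(|C| + 1) / η, by positivity, ?_⟩
    rw [div_div_eq_mul_div, div_lt_iff₀ (by positivity), mul_comm]
    gcongr
    exact (le_abs_self C).trans_lt (lt_add_one _)
  let f : BoundedContinuousFunction ℝ ℝ := .ofNormedAddCommGroup (fun x => min (max x 0) M)
    (by fun_prop) M fun x => by
      rw [Real.norm_of_nonneg (le_min (le_max_right _ _) hM.le)]
      exact min_le_right _ _
  have hlim := ProbabilityMeasure.tendsto_iff_forall_integral_tendsto.1 h.tendsto f
  simp only [ProbabilityMeasure.coe_mk, integral_map (h.forall_aemeasurable _)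
    f.continuous.aestronglyMeasurable, integral_map h.aemeasurable_limit
    f.continuous.aestronglyMeasurable] at hlim
  filter_upwards [hlim.eventually_lt_const (lt_add_of_pos_right _ (sub_pos.2 hCM))] with k hk
  have hsq : Integrable (fun ω => X k ω ^ 2 / M) (μ k) := (hX k).integrable_sq.div_const M
  have hpos := ((hX k).integrable one_le_two).pos_part
  have hint : Integrable (fun ω => f (X k ω)) (μ k) :=
    hpos.inf (integrable_const M)
  calc ∫ ω, max (X k ω) 0 ∂μ k ≤ ∫ ω, (f (X k ω) + X k ω ^ 2 / M) ∂μ k :=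
        integral_mono hpos (hint.add hsq) fun ω => max_zero_le_min_add_sq_div hM
    _ = ∫ ω, f (X k ω) ∂μ k + (∫ ω, X k ω ^ 2 ∂μ k) / M := by
        rw [integral_add hint hsq, integral_div]
    _ ≤ ∫ ω, f (Z ω) ∂μ' + (η - C / M) + C / M := by
        gcongr
        exact hC k
    _ ≤ ∫ ω, max (Z ω) 0 ∂μ' + η := by
        rw [add_assoc, sub_add_cancel]
        gcongr
        · exact hZ.pos_part.inf (integrable_const M)
        · exact hZ.pos_part
        · exact fun ω => min_le_left (max (Z ω) 0) M

/-- The expected excess `E (Z - t)⁺` of a standard Gaussian `Z` over the threshold `t`. -/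
def gaussianExcess (t : ℝ) : ℝ := ∫ x, max (x - t) 0 ∂gaussianReal 0 1

theorem tendstoInDistribution_labelSum {p : unitInterval} (hp : 0 < p) :
    TendstoInDistribution (fun (N : ℕ) (ω : Fin N → SignType) => labelSum ω / √(N * p))
      Filter.atTop id (fun N => Measure.pi fun _ : Fin N => labelLaw p) (gaussianReal 0 1) := by
  have hp' : (0 : ℝ) < p := unitInterval.coe_pos.2 hp
  convert! tendstoInDistribution_inv_sqrt_mul_sum_pi (ν := labelLaw p)
    (f := fun s => (s : ℝ) / √p) .of_discrete ?_ ?_ using 3 with N ω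
  · rw [Real.sqrt_mul N.cast_nonneg, ← Finset.sum_div, labelSum]
    ring
  · rw [integral_labelLaw]
    simp
    ring
  · simp only [Pi.pow_apply, div_pow, Real.sq_sqrt hp'.le]
    rw [integral_labelLaw]
    simp
    field_simp
    norm_num

theorem eventually_integral_labelSum_excess_le {p : unitInterval} (hp : 0 < p) (t : ℝ) {η : ℝ}
    (hη : 0 < η) :
    ∀ᶠ N : ℕ in Filter.atTop, ∫ ω, max (labelSum ω / √(N * p) - t) 0
      ∂Measure.pi (fun _ : Fin N => labelLaw p) ≤ gaussianExcess t + η := by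
  have hlim := (tendstoInDistribution_labelSum hp).continuous_comp (g := fun x => x - t)
    (by fun_prop)
  refine eventually_integral_max_zero_le_add hlim (fun N => .of_discrete) (C := 2 + 2 * t ^ 2)
    (fun N => ?_) (IsGaussian.integrable_fun_id.sub (integrable_const t)) hη
  calc ∫ ω, (labelSum ω / √(N * p) - t) ^ 2 ∂Measure.pi (fun _ : Fin N => labelLaw p)
      ≤ ∫ ω, (2 * (labelSum ω ^ 2 / (N * p)) + 2 * t ^ 2)
          ∂Measure.pi (fun _ : Fin N => labelLaw p) := by
        refine integral_mono .of_finite .of_finite fun ω => ?_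
        have hsq : labelSum ω ^ 2 / (N * p) = (labelSum ω / √(N * p)) ^ 2 := by
          rw [div_pow, Real.sq_sqrt (mul_nonneg N.cast_nonneg p.2.1)]
        simp only [hsq]
        linarith [sq_nonneg (labelSum ω / √(N * p) + t)]
    _ = 2 * ((N * p) / (N * p)) + 2 * t ^ 2 := by
        rw [integral_add .of_finite .of_finite, integral_const_mul, integral_div,
          integral_labelSum_sq]
        simp
    _ ≤ 2 + 2 * t ^ 2 := by linarith [div_self_le_one ((N : ℝ) * p)]

end CentralLimit

/-! ### Power of Gaussian threshold tests -/

section Gaussian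

theorem integrable_excess (t : ℝ) : Integrable (fun x => max (x - t) 0) (gaussianReal 0 1) :=
  ((IsGaussian.integrable_fun_id (μ := gaussianReal 0 1)).sub (integrable_const t)).pos_part

theorem gaussianExcess_le_add_abs_sub (s t : ℝ) :
    gaussianExcess s ≤ gaussianExcess t + |s - t| := by
  calc gaussianExcess s ≤ ∫ x, (max (x - t) 0 + |s - t|) ∂gaussianReal 0 1 := by
        refine integral_mono (integrable_excess s)
          ((integrable_excess t).add (integrable_const _)) fun x => max_le ?_ (by positivity)
        linarith [le_max_left (x - t) 0, neg_abs_le (s - t)]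
    _ = gaussianExcess t + |s - t| := by
        rw [integral_add (integrable_excess t) (integrable_const _)]
        simp [gaussianExcess]

theorem gaussianExcess_neg (t : ℝ) : gaussianExcess (-t) = t + gaussianExcess t := by
  have hid := IsGaussian.integrable_fun_id (μ := gaussianReal 0 1)
  have hadd : Integrable (fun x => x + t) (gaussianReal 0 1) := hid.add (integrable_const t)
  have hneg : Integrable (fun x => max (-x - t) 0) (gaussianReal 0 1) :=
    (hid.neg.sub (integrable_const t)).pos_part
  calc gaussianExcess (-t) = ∫ x, ((x + t) + max (-x - t) 0) ∂gaussianReal 0 1 := by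
        refine integral_congr_ae (.of_forall fun x => ?_)
        rcases le_total 0 (x + t) with h | h
        · simp [max_eq_left h, max_eq_right (show -x - t ≤ 0 by linarith)]
        · simp [max_eq_right h, max_eq_left (show 0 ≤ -x - t by linarith)]
    _ = t + ∫ x, max (-x - t) 0 ∂gaussianReal 0 1 := by
        rw [integral_add hadd hneg, integral_add hid (integrable_const t)]
        simp
    _ = t + gaussianExcess t := by
        have hsymm := gaussianReal_map_neg (μ := 0) (v := 1)
        rw [neg_zero] at hsymm
        rw [gaussianExcess]
        conv_rhs => rw [← hsymm, integral_map (by fun_prop) (by fun_prop)]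

theorem integral_sq_gaussianReal : ∫ x, x ^ 2 ∂gaussianReal 0 1 = 1 := by
  have h := variance_fun_id_gaussianReal (μ := 0) (v := 1)
  rw [variance_eq_integral measurable_id'.aemeasurable] at h
  simpa using h

theorem gaussianExcess_le_inv {K : ℝ} (hK : 0 < K) : gaussianExcess K ≤ K⁻¹ := by
  calc gaussianExcess K ≤ ∫ x, x ^ 2 / K ∂gaussianReal 0 1 := by
        refine integral_mono (integrable_excess K)
          ((memLp_id_gaussianReal 2).integrable_sq.div_const K) fun x => max_le ?_ (by positivity)
        rw [le_div_iff₀ hK]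
        nlinarith [sq_nonneg x, sq_nonneg (x - 2 * K)]
    _ = K⁻¹ := by rw [integral_div, integral_sq_gaussianReal, one_div]

theorem gaussianReal_real_le_inv_sq {K : ℝ} (hK : 0 < K) {s : Set ℝ} (hs : ∀ x ∈ s, K ≤ |x|) :
    (gaussianReal 0 1).real s ≤ (K ^ 2)⁻¹ := by
  have h := meas_ge_le_variance_div_sq (memLp_id_gaussianReal (μ := 0) (v := 1) 2) hK
  simp only [id_eq, integral_id_gaussianReal, sub_zero, variance_id_gaussianReal, NNReal.coe_one,
    one_div] at h
  exact ENNReal.toReal_le_of_le_ofReal (by positivity) ((measure_mono hs).trans h)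

theorem exists_measureReal_Ioi_eq {ν : Measure ℝ} [IsProbabilityMeasure ν] [NullSingletonClass ν]
    {α : ℝ} (h0 : 0 < α) (h1 : α < 1) : ∃ t, ν.real (Set.Ioi t) = α := by
  have hcont : Continuous fun t => ν.real (Set.Iic t) := by
    have hint (t : ℝ) :
        ν.real (Set.Iic t) = ν.real (Set.Iic 0) + ∫ _ in (0 : ℝ)..t, (1 : ℝ) ∂ν := by
      rw [← intervalIntegral.integral_Iic_sub_Iic (integrable_const _).integrableOn
        (integrable_const _).integrableOn]
      simp
    rw [funext hint]
    exact continuous_const.add (intervalIntegral.continuous_primitive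
      (fun a b => intervalIntegrable_const) 0)
  obtain ⟨a, ha⟩ := ((tendsto_cdf_atBot ν).eventually_lt_const (sub_pos.2 h1)).exists
  obtain ⟨b, hb⟩ := ((tendsto_cdf_atTop ν).eventually_const_lt (sub_lt_self 1 h0)).exists
  rw [cdf_eq_real] at ha hb
  obtain ⟨t, ht : ν.real (Set.Iic t) = 1 - α⟩ :=
    mem_range_of_exists_le_of_exists_ge hcont ⟨a, ha.le⟩ ⟨b, hb.le⟩
  refine ⟨t, ?_⟩
  rw [← Set.compl_Iic, probReal_compl_eq_one_sub measurableSet_Iic, ht, sub_sub_cancel]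

theorem gaussianReal_real_eq_setIntegral_exp (μ : ℝ) {s : Set ℝ} (hs : MeasurableSet s) :
    (gaussianReal μ 1).real s = ∫ x in s, Real.exp (μ * x - μ ^ 2 / 2) ∂gaussianReal 0 1 := by
  have hpdf (x : ℝ) : gaussianPDFReal μ 1 x =
      gaussianPDFReal 0 1 x * Real.exp (μ * x - μ ^ 2 / 2) := by
    simp only [gaussianPDFReal, NNReal.coe_one, mul_one, mul_assoc, ← Real.exp_add]
    congr 2
    ring
  rw [← integral_indicator_one hs, ← integral_indicator hs,
    integral_gaussianReal_eq_integral_smul one_ne_zero,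
    integral_gaussianReal_eq_integral_smul one_ne_zero]
  refine integral_congr_ae (.of_forall fun x => ?_)
  by_cases hx : x ∈ s <;> simp [hx, hpdf]

theorem le_gaussianReal_real (μ : ℝ) {s : Set ℝ} (hs : MeasurableSet s) :
    (gaussianReal 0 1).real s + μ * ∫ x in s, x ∂gaussianReal 0 1 - μ ^ 2 / 2 ≤
      (gaussianReal μ 1).real s := by
  have hid : IntegrableOn (fun x => μ * x) s (gaussianReal 0 1) :=
    (IsGaussian.integrable_fun_id.const_mul μ).integrableOn
  have hconst := (integrable_const (μ := (gaussianReal 0 1).restrict s) (1 - μ ^ 2 / 2))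
  have hexp : Integrable (fun x => Real.exp (μ * x - μ ^ 2 / 2)) (gaussianReal 0 1) := by
    simp only [Real.exp_sub]
    exact (integrable_exp_mul_gaussianReal μ).div_const _
  calc (gaussianReal 0 1).real s + μ * ∫ x in s, x ∂gaussianReal 0 1 - μ ^ 2 / 2
      ≤ μ * ∫ x in s, x ∂gaussianReal 0 1 + (gaussianReal 0 1).real s * (1 - μ ^ 2 / 2) := by
        nlinarith [sq_nonneg μ, measureReal_le_one (μ := gaussianReal 0 1) (s := s)]
    _ = ∫ x in s, (μ * x + (1 - μ ^ 2 / 2)) ∂gaussianReal 0 1 := by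
        rw [integral_add hid hconst, integral_const_mul]
        simp
    _ ≤ ∫ x in s, Real.exp (μ * x - μ ^ 2 / 2) ∂gaussianReal 0 1 :=
        integral_mono (hid.add hconst) hexp.integrableOn fun x => by
          linarith [Real.add_one_le_exp (μ * x - μ ^ 2 / 2)]
    _ = (gaussianReal μ 1).real s := (gaussianReal_real_eq_setIntegral_exp μ hs).symm

theorem setIntegral_Ioi_gaussianReal (t : ℝ) :
    ∫ x in Set.Ioi t, x ∂gaussianReal 0 1 =
      (gaussianReal 0 1).real (Set.Ioi t) * t + gaussianExcess t := by
  have hexcess : gaussianExcess t = ∫ x in Set.Ioi t, (x - t) ∂gaussianReal 0 1 := by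
    rw [gaussianExcess, ← integral_indicator measurableSet_Ioi]
    congr with x
    rcases lt_or_ge t x with h | h
    · simp [Set.indicator_of_mem (Set.mem_Ioi.2 h), h.le]
    · simp [h]
  rw [hexcess, integral_sub IsGaussian.integrable_fun_id.integrableOn (integrable_const t)]
  simp

theorem measureReal_le_one_sub_tradeoff {Ω : Type*} [MeasurableSpace Ω] (U V : Measure Ω)
    [IsProbabilityMeasure V] {s : Set Ω} (hs : MeasurableSet s) :
    V.real s ≤ 1 - tradeoff U V (U.real s) := by
  have hφ : IsTest (s.indicator (1 : Ω → ℝ)) := ⟨measurable_one.indicator hs, fun x => by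
    by_cases hx : x ∈ s <;> simp [hx]⟩
  have h := tradeoff_le (U := U) (V := V) hφ (integral_indicator_one hs).le
  rw [integral_indicator_one hs] at h
  linarith

theorem le_one_sub_gaussianTradeoff (μ t : ℝ) {α : ℝ}
    (hα : (gaussianReal 0 1).real (Set.Ioi t) = α) :
    α + μ * (α * t + gaussianExcess t) - μ ^ 2 / 2 ≤ 1 - gaussianTradeoff μ α := by
  subst hα
  rw [← setIntegral_Ioi_gaussianReal]
  exact (le_gaussianReal_real μ measurableSet_Ioi).trans
    (measureReal_le_one_sub_tradeoff _ _ measurableSet_Ioi)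

theorem exists_mem_Icc_measureReal_Ioi_eq {K α : ℝ} (hK : 0 < K) (h0 : (K ^ 2)⁻¹ < α)
    (h1 : (K ^ 2)⁻¹ < 1 - α) : ∃ t ∈ Set.Icc (-K) K, (gaussianReal 0 1).real (Set.Ioi t) = α := by
  have hpos : 0 < (K ^ 2)⁻¹ := by positivity
  have := nullSingletonClass_gaussianReal (μ := 0) one_ne_zero
  obtain ⟨t, ht⟩ := exists_measureReal_Ioi_eq (ν := gaussianReal 0 1) (hpos.trans h0)
    (sub_pos.1 (hpos.trans h1))
  refine ⟨t, ⟨?_, ?_⟩, ht⟩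
  · by_contra! hlt
    refine h1.not_ge ?_
    rw [← ht, ← probReal_compl_eq_one_sub measurableSet_Ioi, Set.compl_Ioi]
    exact gaussianReal_real_le_inv_sq hK fun x (hx : x ≤ t) => le_abs.2 (.inr (by linarith))
  · by_contra! hlt
    refine h0.not_ge ?_
    rw [← ht]
    exact gaussianReal_real_le_inv_sq hK fun x (hx : t < x) => le_abs.2 (.inl (by linarith))

theorem exists_gaussian_threshold {K : ℝ} (hK : 0 < K) {α : ℝ} (hα : α ∈ Set.Icc (0 : ℝ) 1) :
    ∃ t ∈ Set.Icc (-K) K, ∀ μ, 0 ≤ μ →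
      α + μ * (α * t + gaussianExcess t - 2 / K) - μ ^ 2 / 2 ≤ 1 - gaussianTradeoff μ α := by
  have hle (t μ : ℝ) (hμ : 0 ≤ μ) (ht : α * t + gaussianExcess t ≤ 2 / K) :
      α + μ * (α * t + gaussianExcess t - 2 / K) - μ ^ 2 / 2 ≤ 1 - gaussianTradeoff μ α := by
    have htrivial : gaussianTradeoff μ α ≤ 1 - α := tradeoff_le_one_sub hα
    linarith [mul_nonpos_of_nonneg_of_nonpos hμ (sub_nonpos.2 ht), sq_nonneg μ]
  have hexcess := gaussianExcess_le_inv hK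
  have hinv : (K ^ 2)⁻¹ * K = K⁻¹ := by field_simp
  have htwo : 2 / K = K⁻¹ + K⁻¹ := by ring
  by_cases h0 : α ≤ (K ^ 2)⁻¹
  · refine ⟨K, ⟨by linarith, le_rfl⟩, fun μ hμ => hle K μ hμ ?_⟩
    linarith [mul_le_mul_of_nonneg_right h0 hK.le]
  by_cases h1 : 1 - α ≤ (K ^ 2)⁻¹
  · refine ⟨-K, ⟨le_rfl, by linarith⟩, fun μ hμ => hle (-K) μ hμ ?_⟩
    rw [gaussianExcess_neg]
    linarith [mul_le_mul_of_nonneg_right h1 hK.le]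
  obtain ⟨t, htK, ht⟩ := exists_mem_Icc_measureReal_Ioi_eq hK (not_le.1 h0) (not_le.1 h1)
  refine ⟨t, htK, fun μ hμ => ?_⟩
  have hpos : 0 ≤ μ * (2 / K) := by positivity
  linarith [le_one_sub_gaussianTradeoff μ t ht]

theorem exists_finite_gaussian_thresholds {η : ℝ} (hη : 0 < η) :
    ∃ F : Set ℝ, F.Finite ∧ ∀ α ∈ Set.Icc (0 : ℝ) 1, ∃ t ∈ F, ∀ μ, 0 ≤ μ →
      α + μ * (α * t + gaussianExcess t - η) - μ ^ 2 / 2 ≤ 1 - gaussianTradeoff μ α := by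
  have hK : 0 < 4 / η := by positivity
  obtain ⟨F, -, hFfin, hF⟩ := Metric.finite_approx_of_totallyBounded
    (isCompact_Icc (a := -(4 / η)) (b := 4 / η)).totallyBounded (η / 4) (by positivity)
  refine ⟨F, hFfin, fun α hα => ?_⟩
  obtain ⟨t, htK, ht⟩ := exists_gaussian_threshold hK hα
  obtain ⟨s, hs, hts⟩ := Set.mem_iUnion₂.1 (hF htK)
  rw [Metric.mem_ball, Real.dist_eq, abs_sub_comm] at hts
  refine ⟨s, hs, fun μ hμ => le_trans ?_ (ht μ hμ)⟩
  have hmul : α * (s - t) ≤ |s - t| :=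
    (mul_le_mul_of_nonneg_left (le_abs_self _) hα.1).trans
      (mul_le_of_le_one_left (abs_nonneg _) hα.2)
  have hshift : α * s + gaussianExcess s - η ≤ α * t + gaussianExcess t - 2 / (4 / η) := by
    rw [div_div_eq_mul_div]
    linarith [gaussianExcess_le_add_abs_sub s t]
  linarith [mul_le_mul_of_nonneg_left hshift hμ]

end Gaussian

/-! ### Power of exchangeable tests for the labels -/

section Power

theorem IsTest.integral_mul_le {Ω : Type*} [MeasurableSpace Ω] {U : Measure Ω} [IsFiniteMeasure U]
    {g : Ω → ℝ} (hg : IsTest g) {W : Ω → ℝ} (hW : Integrable W U) (t : ℝ) :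
    ∫ ω, g ω * W ω ∂U ≤ (∫ ω, g ω ∂U) * t + ∫ ω, max (W ω - t) 0 ∂U := by
  have hexcess : Integrable (fun ω => max (W ω - t) 0) U := (hW.sub (integrable_const t)).pos_part
  rw [← integral_mul_const, ← integral_add (hg.integrable.mul_const t) hexcess]
  refine integral_mono
    (hW.bdd_mul (c := 1) hg.measurable.aestronglyMeasurable (.of_forall fun ω => ?_))
    ((hg.integrable.mul_const t).add hexcess) fun ω => ?_
  · rw [Real.norm_of_nonneg (hg.mem_Icc ω).1]
    exact (hg.mem_Icc ω).2
  · have h := mul_le_mul_of_nonneg_left (le_max_left (W ω - t) 0) (hg.mem_Icc ω).1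
    have h' := mul_le_of_le_one_left (le_max_right (W ω - t) 0) (hg.mem_Icc ω).2
    beta_reduce
    linarith

theorem IsTest.abs_integral_mul_le_one {Ω : Type*} [MeasurableSpace Ω] {U : Measure Ω}
    [IsProbabilityMeasure U] {g : Ω → ℝ} (hg : IsTest g) {W : Ω → ℝ} (hW : MemLp W 2 U)
    (hW1 : ∫ ω, W ω ^ 2 ∂U ≤ 1) : |∫ ω, g ω * W ω ∂U| ≤ 1 := by
  calc |∫ ω, g ω * W ω ∂U| ≤ ∫ ω, |g ω * W ω| ∂U := abs_integral_le_integral_abs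
    _ ≤ ∫ ω, (W ω ^ 2 + 1) / 2 ∂U := by
        refine integral_mono_of_nonneg (.of_forall fun ω => abs_nonneg _)
          ((hW.integrable_sq.add (integrable_const 1)).div_const 2) (.of_forall fun ω => ?_)
        simp only [abs_mul, abs_of_nonneg (hg.mem_Icc ω).1]
        refine (mul_le_of_le_one_left (abs_nonneg _) (hg.mem_Icc ω).2).trans ?_
        rw [← sq_abs (W ω)]
        linarith [sq_nonneg (|W ω| - 1)]
    _ ≤ 1 := by
        rw [integral_div, integral_add hW.integrable_sq (integrable_const 1)]
        simp only [integral_const, probReal_univ, smul_eq_mul]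
        linarith

theorem IsTest.integral_one_add_mul_le {Ω : Type*} [MeasurableSpace Ω] {U : Measure Ω}
    [IsProbabilityMeasure U] {g : Ω → ℝ} (hg : IsTest g) {x W : Ω → ℝ}
    (hx : Integrable (fun ω => x ω * g ω) U) (hW : MemLp W 2 U) (hW1 : ∫ ω, W ω ^ 2 ∂U ≤ 1)
    {μ r : ℝ} (hμ : 0 ≤ μ) (hr : |∫ ω, x ω * g ω ∂U - μ / 2 * ∫ ω, g ω * W ω ∂U| ≤ r) (t : ℝ) :
    ∫ ω, (1 + x ω) * g ω ∂U ≤ ∫ ω, (1 - x ω) * g ω ∂U +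
      μ * ((∫ ω, (1 - x ω) * g ω ∂U) * t + ∫ ω, max (W ω - t) 0 ∂U + |t| * (μ / 2 + r)) +
        2 * r := by
  have hadd : ∫ ω, (1 + x ω) * g ω ∂U = ∫ ω, g ω ∂U + ∫ ω, x ω * g ω ∂U := by
    rw [← integral_add hg.integrable hx]
    simp only [one_add_mul]
  have hsub : ∫ ω, (1 - x ω) * g ω ∂U = ∫ ω, g ω ∂U - ∫ ω, x ω * g ω ∂U := by
    rw [← integral_sub hg.integrable hx]
    simp only [one_sub_mul]
  rw [hadd, hsub]
  set m := ∫ ω, g ω ∂U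
  set u := ∫ ω, x ω * g ω ∂U
  have hdual := hg.integral_mul_le (hW.integrable one_le_two) t
  have hgW := abs_le.1 (hg.abs_integral_mul_le_one hW hW1)
  set w := ∫ ω, g ω * W ω ∂U
  obtain ⟨hr₁, hr₂⟩ := abs_le.1 hr
  have hu : |u| ≤ μ / 2 + r := by
    rw [abs_le]
    constructor <;> nlinarith
  have hut : u * t ≤ |t| * (μ / 2 + r) := by
    calc u * t ≤ |t| * |u| := by rw [mul_comm, ← abs_mul]; exact le_abs_self _
      _ ≤ |t| * (μ / 2 + r) := mul_le_mul_of_nonneg_left hu (abs_nonneg t)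
  have hw : w ≤ (m - u) * t + ∫ ω, max (W ω - t) 0 ∂U + |t| * (μ / 2 + r) := by linarith
  linarith [mul_le_mul_of_nonneg_left hw hμ]

theorem integral_labelsLaw_dirac_one_le {N : ℕ} {p : unitInterval} (hA : 0 < (N : ℝ) * p)
    {i : Fin (N + 1)} {g : (Fin (N + 1) → SignType) → ℝ} (hg01 : IsTest g)
    (hg : SwapInvariant i g) {μ : ℝ} (hμ : μ = 2 / √(N * p)) (t : ℝ) :
    ∫ l, g l ∂labelsLaw p i (Measure.dirac 1) ≤
      ∫ l, g l ∂labelsLaw p i (Measure.dirac (-1)) +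
        μ * ((∫ l, g l ∂labelsLaw p i (Measure.dirac (-1))) * t +
          ∫ ω, max (labelSum ω / √(N * p) - t) 0 ∂Measure.pi (fun _ : Fin N => labelLaw p) +
          |t| * (μ / 2 + (5 / 4 * μ ^ 2 + μ ^ 4 / 4))) + 2 * (5 / 4 * μ ^ 2 + μ ^ 4 / 4) := by
  have hsq : √(N * p) ^ 2 = N * p := Real.sq_sqrt hA.le
  have hμ2 : μ ^ 2 = 4 / (N * p) := by rw [hμ, div_pow, hsq]; norm_num
  have hr : 5 / ((N : ℝ) * p) + 4 / (N * p) ^ 2 = 5 / 4 * μ ^ 2 + μ ^ 4 / 4 := by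
    rw [show μ ^ 4 = (μ ^ 2) ^ 2 by ring, hμ2]
    ring
  have hscale : ∫ l, g l * (labelSum (i.removeNth l) / (N * p)) ∂labelsLaw p i (labelLaw 1) =
      μ / 2 * ∫ l, g l * (labelSum (i.removeNth l) / √(N * p)) ∂labelsLaw p i (labelLaw 1) := by
    rw [← integral_const_mul]
    congr with l
    rw [hμ]
    nth_rw 1 [← hsq]
    field_simp
  have happrox := abs_integral_label_mul_sub_le hA hg hg01
  rw [hr, hscale] at happrox
  have hvar : ∫ l, (labelSum (i.removeNth l) / √(N * p)) ^ 2 ∂labelsLaw p i (labelLaw 1) = 1 := by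
    rw [integral_removeNth_labelsLaw p i _ fun ω => (labelSum ω / √(N * p)) ^ 2]
    simp only [div_pow, hsq, integral_div, integral_labelSum_sq, div_self hA.ne']
  have h := hg01.integral_one_add_mul_le .of_finite .of_discrete hvar.le
    (by rw [hμ]; positivity) happrox t
  rw [integral_removeNth_labelsLaw p i _ fun ω => max (labelSum ω / √(N * p) - t) 0] at h
  rw [integral_labelsLaw_dirac p i (by decide), integral_labelsLaw_dirac p i (by decide)]
  simpa [← sub_eq_add_neg] using h

/-- The tests on the labels of `n` records that do not distinguish the record `i` from the other
cloned records have at most the power of the Gaussian test with parameter `μ`, up to the error `d`,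
for deciding whether the label of `i` is `-1` or `1`. -/
def LabelPowerBound (p : unitInterval) (μ : ℝ) (n : ℕ) (d : ℝ) : Prop :=
  ∀ (i : Fin n) (g : (Fin n → SignType) → ℝ), IsTest g → SwapInvariant i g →
    ∫ l, g l ∂labelsLaw p i (Measure.dirac 1) ≤
      1 - gaussianTradeoff μ (∫ l, g l ∂labelsLaw p i (Measure.dirac (-1))) + d

theorem labelPowerBound_one (p : unitInterval) (μ : ℝ) (n : ℕ) : LabelPowerBound p μ n 1 := by
  intro i g hg _
  have hsize := hg.integral_mem_Icc (U := labelsLaw p i (Measure.dirac (-1)))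
  have hpower := hg.integral_mem_Icc (U := labelsLaw p i (Measure.dirac 1))
  have hle : gaussianTradeoff μ (∫ l, g l ∂labelsLaw p i (Measure.dirac (-1))) ≤ _ :=
    tradeoff_le_one_sub hsize
  linarith [hsize.1, hpower.2]

theorem eventually_labelPowerBound {p : unitInterval} (hp : 0 < p) {μ : ℕ → ℝ}
    (hμ : ∀ N : ℕ, μ N = 2 / √(N * p)) {η : ℝ} (hη : 0 < η) :
    ∀ᶠ N in Filter.atTop, LabelPowerBound p (μ N) (N + 1) (η * μ N) := by
  have hp' : 0 < (p : ℝ) := unitInterval.coe_pos.2 hp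
  have hμlim : Filter.Tendsto μ Filter.atTop (nhds 0) := by
    rw [funext hμ]
    exact tendsto_const_nhds.div_atTop
      (Real.tendsto_sqrt_atTop.comp (tendsto_natCast_atTop_atTop.atTop_mul_const hp'))
  obtain ⟨F, hFfin, hF⟩ := exists_finite_gaussian_thresholds (show 0 < η / 3 by positivity)
  have hexcess : ∀ᶠ N : ℕ in Filter.atTop, ∀ t ∈ F,
      ∫ ω, max (labelSum ω / √(N * p) - t) 0 ∂Measure.pi (fun _ : Fin N => labelLaw p) ≤
        gaussianExcess t + η / 3 :=
    (Filter.eventually_all_finite hFfin).2 fun t _ =>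
      eventually_integral_labelSum_excess_le hp t (by positivity)
  have hsmall : ∀ᶠ N in Filter.atTop, ∀ t ∈ F,
      |t| * (μ N / 2 + (5 / 4 * μ N ^ 2 + μ N ^ 4 / 4)) + 2 * (5 / 4 * μ N + μ N ^ 3 / 4) + μ N / 2
        < η / 3 := by
    refine (Filter.eventually_all_finite hFfin).2 fun t _ => ?_
    have hcont : Continuous fun x : ℝ =>
        |t| * (x / 2 + (5 / 4 * x ^ 2 + x ^ 4 / 4)) + 2 * (5 / 4 * x + x ^ 3 / 4) + x / 2 := by
      fun_prop
    refine ((hcont.tendsto 0).comp hμlim).eventually_lt_const ?_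
    simpa using hη
  filter_upwards [hexcess, hsmall, Filter.eventually_gt_atTop 0] with N hN₁ hN₂ hN i g hg01 hg
  have hμ0 : 0 ≤ μ N := by rw [hμ]; positivity
  obtain ⟨t, htF, ht⟩ := hF _ (hg01.integral_mem_Icc (U := labelsLaw p i (Measure.dirac (-1))))
  have hpower := integral_labelsLaw_dirac_one_le (by positivity) hg01 hg (hμ N) t
  linarith [ht _ hμ0, mul_le_mul_of_nonneg_left (hN₁ t htF) hμ0,
    mul_le_mul_of_nonneg_left (hN₂ t htF).le hμ0]

/-- The least error `d ≥ 0` for which `LabelPowerBound p μ n d` holds. -/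
def labelPowerError (p : unitInterval) (μ : ℝ) (n : ℕ) : ℝ :=
  sInf {d : ℝ | 0 ≤ d ∧ LabelPowerBound p μ n d}

theorem labelPowerBound_labelPowerError (p : unitInterval) (μ : ℝ) (n : ℕ) :
    LabelPowerBound p μ n (labelPowerError p μ n) := by
  intro i g hg01 hg
  rw [← sub_le_iff_le_add']
  exact le_csInf ⟨1, zero_le_one, labelPowerBound_one p μ n⟩
    fun d hd => sub_le_iff_le_add'.2 (hd.2 i g hg01 hg)

end Power

section Shuffle

theorem gdpParam_eq (ε : ℝ) (n : ℕ) : gdpParam ε n = 2 / √(((n : ℝ) - 1) * Real.exp (-ε)) := by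
  rw [gdpParam, Real.sqrt_mul' _ (Real.exp_pos _).le, ← Real.exp_half, neg_div, Real.exp_neg]
  field_simp

theorem isLittleO_labelPowerError {ε : ℝ} {p : unitInterval} (hp : (p : ℝ) = Real.exp (-ε)) :
    (fun n => labelPowerError p (gdpParam ε n) n) =o[Filter.atTop] gdpParam ε := by
  have hp0 : 0 < p := unitInterval.coe_pos.1 (hp ▸ Real.exp_pos _)
  refine Asymptotics.isLittleO_iff.2 fun η hη => ?_
  rw [← Filter.map_add_atTop_eq_nat 1, Filter.eventually_map]
  filter_upwards [eventually_labelPowerBound hp0 (μ := fun N => gdpParam ε (N + 1))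
    (fun N => by simp [gdpParam_eq, hp]) hη] with N hN
  have hμ : 0 ≤ gdpParam ε (N + 1) := by rw [gdpParam_eq]; positivity
  have herror : 0 ≤ labelPowerError p (gdpParam ε (N + 1)) (N + 1) :=
    Real.sInf_nonneg fun d hd => hd.1
  rw [Real.norm_of_nonneg herror, Real.norm_of_nonneg hμ]
  exact csInf_le ⟨0, fun d hd => hd.1⟩ ⟨by positivity, hN⟩

variable {D : Type u} {S : ℕ → Type v} [∀ i, MeasurableSpace (S i)]
  {R : (i : ℕ) → D → Kernel ((j : Fin i) → S j) (S i)}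

theorem IsLDPProcess.ofReal_exp_neg_smul_le {ε : ℝ} {n : ℕ} (hR : IsLDPProcess ε n R) :
    ∀ k < n, ∀ z x x', ENNReal.ofReal (Real.exp (-ε)) • R k x z ≤ R k x' z := by
  refine fun k hk z x x' => Measure.le_iff.2 fun E hE => ?_
  calc ENNReal.ofReal (Real.exp (-ε)) * R k x z E
      ≤ ENNReal.ofReal (Real.exp (-ε)) * (ENNReal.ofReal (Real.exp ε) * R k x' z E) :=
        mul_le_mul_right (hR k hk z x x' E hE) _
    _ = R k x' z E := by
        rw [← mul_assoc, ← ENNReal.ofReal_mul (Real.exp_pos _).le, ← Real.exp_add]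
        simp

theorem isGDPUpTo_shuffledLaw [∀ i x, IsMarkovKernel (R i x)] {p : unitInterval} (hp : p < 1)
    {n : ℕ} (hR : ∀ k < n, ∀ z x x', ENNReal.ofReal p • R k x z ≤ R k x' z) (μ : ℝ) :
    IsGDPUpTo (shuffledLaw R n) μ (labelPowerError p μ n) := by
  rintro X₀ X₁ ⟨i, -, hX⟩ α hα
  refine le_tradeoff hα.1 fun φ hφ hle => ?_
  obtain ⟨g, hg01, hg, hφg⟩ :=
    exists_isTest_labels hp hR X₀ i (fun s => if s = 1 then X₁ i else X₀ i) hφ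
  have hX₀ := hφg (-1) (by decide)
  have hX₁ := hφg 1 (by decide)
  have hupdate : Function.update X₀ i (X₁ i) = X₁ :=
    Function.update_eq_iff.2 ⟨rfl, fun j hj => hX j hj⟩
  rw [if_neg (by decide), Function.update_eq_self] at hX₀
  rw [if_pos rfl, hupdate] at hX₁
  have hpower := labelPowerBound_labelPowerError p μ n i g hg01 hg
  rw [← hX₀, ← hX₁] at hpower
  have hanti : gaussianTradeoff μ α ≤ gaussianTradeoff μ (∫ z, φ z ∂shuffledLaw R n X₀) :=
    tradeoff_antitone hφ.integral_mem_Icc.1 hle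
  linarith

end Shuffle

/-! ### Gaussians with a common covariance matrix -/

section MultivariateGaussian

open Matrix Measure

theorem tradeoff_le_tradeoff_map_conv {E : Type*} [AddMonoid E] [MeasurableSpace E]
    [MeasurableAdd₂ E] {Ω : Type*} [MeasurableSpace Ω] {U V : Measure Ω} [IsProbabilityMeasure U]
    [IsProbabilityMeasure V] {f : Ω → E} (hf : Measurable f) (N : Measure E)
    [IsProbabilityMeasure N] {α : ℝ} (hα : 0 ≤ α) :
    tradeoff U V α ≤ tradeoff (U.map f ∗ N) (V.map f ∗ N) α := by
  have := isProbabilityMeasure_map (μ := U) hf.aemeasurable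
  have := isProbabilityMeasure_map (μ := V) hf.aemeasurable
  calc tradeoff U V α ≤ tradeoff (U.map f) (V.map f) α := tradeoff_le_tradeoff_map hf hα
    _ ≤ tradeoff ((U.map f).prod N) ((V.map f).prod N) α := tradeoff_le_tradeoff_prod N hα
    _ ≤ _ := tradeoff_le_tradeoff_map measurable_add hα

variable {ι : Type*} [Fintype ι] {S : Matrix ι ι ℝ}

theorem posSemidef_sub_vecMulVec (hS : S.PosSemidef) {w : ι → ℝ} (hw : w ⬝ᵥ S *ᵥ w = 1) :
    (S - vecMulVec (S *ᵥ w) (S *ᵥ w)).PosSemidef := by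
  have hsymm (x y : ι → ℝ) : x ⬝ᵥ S *ᵥ y = y ⬝ᵥ S *ᵥ x := by
    rw [dotProduct_mulVec, ← mulVec_transpose, show Sᵀ = S from hS.isHermitian, dotProduct_comm]
  refine .of_dotProduct_mulVec_nonneg
    (hS.isHermitian.sub (by simpa using (posSemidef_vecMulVec_self_star (S *ᵥ w)).isHermitian))
    fun x => ?_
  have h := hS.dotProduct_mulVec_nonneg (x - (x ⬝ᵥ S *ᵥ w) • w)
  simp only [star_trivial, mulVec_sub, mulVec_smul, sub_dotProduct, dotProduct_sub, smul_dotProduct,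
    dotProduct_smul, smul_eq_mul, hsymm w x, hw] at h
  simp only [star_trivial, sub_mulVec, vecMulVec_mulVec, dotProduct_sub, dotProduct_smul,
    dotProduct_comm (S *ᵥ w) x]
  simp only [MulOpposite.smul_eq_mul_unop, MulOpposite.unop_op]
  linarith

variable [DecidableEq ι]

theorem multivariateGaussian_vecMulVec_add {T : Matrix ι ι ℝ} (hT : T.PosSemidef)
    (m v : EuclideanSpace ℝ ι) (a : ℝ) :
    multivariateGaussian (m + a • v) (vecMulVec v.ofLp v.ofLp + T) =
      (gaussianReal a 1).map (fun y => m + y • v) ∗ multivariateGaussian 0 T := by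
  have hf : Measurable fun y : ℝ => m + y • v := by fun_prop
  have := isProbabilityMeasure_map (μ := gaussianReal a 1) hf.aemeasurable
  have hv : (vecMulVec v.ofLp v.ofLp).PosSemidef := by
    simpa using posSemidef_vecMulVec_self_star v.ofLp
  refine ext_of_charFun (funext fun s => ?_)
  have hline : charFun ((gaussianReal a 1).map fun y => m + y • v) s =
      Complex.exp (inner ℝ s m * Complex.I) * charFun (gaussianReal a 1) (inner ℝ s v) := by
    rw [charFun_apply, charFun_apply_real, integral_map hf.aemeasurable (by fun_prop),
      ← integral_const_mul]
    congr with y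
    rw [← Complex.exp_add, real_inner_comm, inner_add_right, inner_smul_right]
    congr 1
    push_cast
    ring
  have hquad : s.ofLp ⬝ᵥ vecMulVec v.ofLp v.ofLp *ᵥ s.ofLp = (inner ℝ s v : ℝ) ^ 2 := by
    rw [vecMulVec_mulVec, EuclideanSpace.inner_eq_star_dotProduct]
    simp [dotProduct_smul, dotProduct_comm, sq]
  rw [charFun_conv, hline, charFun_gaussianReal, charFun_multivariateGaussian (hv.add hT),
    charFun_multivariateGaussian hT, add_mulVec, dotProduct_add, hquad, inner_add_right,
    inner_smul_right, inner_zero_right, ← Complex.exp_add, ← Complex.exp_add]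
  congr 1
  push_cast
  ring

theorem map_inner_multivariateGaussian (hS : S.PosSemidef) (m w : EuclideanSpace ℝ ι) :
    (multivariateGaussian m S).map (fun z => inner ℝ w z) =
      gaussianReal (inner ℝ w m) (w.ofLp ⬝ᵥ S *ᵥ w.ofLp).toNNReal := by
  have hmean : ∫ z, innerSL ℝ w z ∂multivariateGaussian m S = inner ℝ w m := by
    rw [(innerSL ℝ w).integral_comp_comm IsGaussian.integrable_fun_id,
      integral_id_multivariateGaussian]
    rfl
  have hvar : Var[innerSL ℝ w; multivariateGaussian m S] = w.ofLp ⬝ᵥ S *ᵥ w.ofLp := by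
    rw [← covarianceBilin_multivariateGaussian hS, covarianceBilin_self IsGaussian.memLp_two_id]
    rfl
  rw [← hmean, ← hvar]
  exact IsGaussian.map_eq_gaussianReal (innerSL ℝ w)

theorem tradeoff_multivariateGaussian_smul (hS : S.PosSemidef) (m : EuclideanSpace ℝ ι)
    {w : ι → ℝ} (hw : w ⬝ᵥ S *ᵥ w = 1) (μ : ℝ) {α : ℝ} (hα : 0 ≤ α) :
    tradeoff (multivariateGaussian m S)
      (multivariateGaussian (m + μ • WithLp.toLp 2 (S *ᵥ w)) S) α = gaussianTradeoff μ α := by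
  set v := WithLp.toLp 2 (S *ᵥ w)
  apply le_antisymm
  · set c := inner ℝ (WithLp.toLp 2 w) m
    have hL : Measurable fun z => inner ℝ (WithLp.toLp 2 w) z - c := by fun_prop
    have hwv : inner ℝ (WithLp.toLp 2 w) v = 1 := by
      rw [EuclideanSpace.inner_toLp_toLp, star_trivial, dotProduct_comm, hw]
    have hmap (a : ℝ) : (multivariateGaussian (m + a • v) S).map
        (fun z => inner ℝ (WithLp.toLp 2 w) z - c) = gaussianReal a 1 := by
      have h := map_inner_multivariateGaussian hS (m + a • v) (WithLp.toLp 2 w)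
      rw [inner_add_right, inner_smul_right, hwv, mul_one, hw, Real.toNNReal_one] at h
      rw [← Function.comp_def (· - c), ← map_map (by fun_prop) (by fun_prop), h,
        gaussianReal_map_sub_const, add_sub_cancel_left]
    have h := tradeoff_le_tradeoff_map (U := multivariateGaussian m S)
      (V := multivariateGaussian (m + μ • v) S) hL hα
    have h0 := hmap 0
    rw [zero_smul, add_zero] at h0
    rwa [h0, hmap] at h
  · have hconv (a : ℝ) := multivariateGaussian_vecMulVec_add
      (posSemidef_sub_vecMulVec hS hw) m v a
    simp only [v, add_sub_cancel] at hconv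
    have h0 := hconv 0
    rw [zero_smul, add_zero] at h0
    rw [h0, hconv]
    exact tradeoff_le_tradeoff_map_conv (by fun_prop) _ hα

theorem tradeoff_multivariateGaussian (hS : S.PosSemidef) (m : EuclideanSpace ℝ ι) (u : ι → ℝ)
    {α : ℝ} (hα : α ∈ Set.Icc (0 : ℝ) 1) :
    tradeoff (multivariateGaussian m S) (multivariateGaussian (m + WithLp.toLp 2 (S *ᵥ u)) S) α =
      gaussianTradeoff √(u ⬝ᵥ S *ᵥ u) α := by
  have hnonneg : 0 ≤ u ⬝ᵥ S *ᵥ u := by simpa using hS.dotProduct_mulVec_nonneg u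
  rcases hnonneg.eq_or_lt with h0 | hpos
  · have hSu : S *ᵥ u = 0 := (hS.dotProduct_mulVec_zero_iff u).1 (by simpa using h0.symm)
    rw [← h0, hSu, Real.sqrt_zero, gaussianTradeoff, tradeoff_self hα]
    simpa using tradeoff_self hα
  · have hμ := Real.sqrt_pos.2 hpos
    set μ := √(u ⬝ᵥ S *ᵥ u) with hμdef
    have hw : (μ⁻¹ • u) ⬝ᵥ S *ᵥ (μ⁻¹ • u) = 1 := by
      rw [mulVec_smul, dotProduct_smul, smul_dotProduct, ← Real.sq_sqrt hnonneg, ← hμdef]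
      simp only [smul_eq_mul]
      field_simp
    rw [← tradeoff_multivariateGaussian_smul hS m hw μ hα.1, ← WithLp.toLp_smul, mulVec_smul,
      smul_inv_smul₀ hμ.ne']

theorem tradeoff_multivariateGaussian_of_posDef (hS : S.PosDef) (m₀ m₁ : EuclideanSpace ℝ ι)
    {α : ℝ} (hα : α ∈ Set.Icc (0 : ℝ) 1) :
    tradeoff (multivariateGaussian m₀ S) (multivariateGaussian m₁ S) α =
      gaussianTradeoff √((m₁ - m₀).ofLp ⬝ᵥ S⁻¹ *ᵥ (m₁ - m₀).ofLp) α := by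
  have hmul : S *ᵥ S⁻¹ *ᵥ (m₁ - m₀).ofLp = (m₁ - m₀).ofLp := by
    rw [mulVec_mulVec, mul_nonsing_inv _ ((isUnit_iff_isUnit_det S).1 hS.isUnit), one_mulVec]
  have h := tradeoff_multivariateGaussian hS.posSemidef m₀ (S⁻¹ *ᵥ (m₁ - m₀).ofLp) hα
  rwa [hmul, WithLp.toLp_ofLp, add_sub_cancel, dotProduct_comm] at h

theorem covMat_posDef {p : ℝ} (hp0 : 0 < p) (hp1 : p < 1) {n : ℕ} (hn : 2 ≤ n) :
    (covMat p n).PosDef := by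
  have hn1 : 0 < (n : ℝ) - 1 := sub_pos.2 (by exact_mod_cast hn)
  have hq : 0 < 1 - p := sub_pos.2 hp1
  refine .of_dotProduct_mulVec_pos ?_ fun x hx => ?_
  · ext j k
    fin_cases j <;> fin_cases k <;> simp [covMat]
  · have hquad : star x ⬝ᵥ covMat p n *ᵥ x = ((n : ℝ) - 1) * (p / 4) *
        ((1 - p) * (x 0 + x 1) ^ 2 + (x 0 - x 1) ^ 2) := by
      simp [covMat, mulVec, dotProduct, Fin.sum_univ_two]
      ring
    rw [hquad]
    refine mul_pos (by positivity) (lt_of_le_of_ne (by positivity) fun h => hx ?_)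
    have hadd : 0 ≤ (1 - p) * (x 0 + x 1) ^ 2 := by positivity
    have hsub := sq_nonneg (x 0 - x 1)
    have hadd0 : x 0 + x 1 = 0 := by
      simpa [hq.ne'] using show (1 - p) * (x 0 + x 1) ^ 2 = 0 by linarith
    have hsub0 : x 0 - x 1 = 0 := by simpa using show (x 0 - x 1) ^ 2 = 0 by linarith
    ext j
    fin_cases j <;> simp <;> linarith

theorem covMat_mulVec (p : ℝ) (n : ℕ) :
    covMat p n *ᵥ ![-1, 1] = (((n : ℝ) - 1) * p / 2) • ![-1, 1] := by
  ext j
  fin_cases j <;> simp [covMat, mulVec, dotProduct, Fin.sum_univ_two] <;> ring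

theorem mahalanobis_covMat {p : ℝ} (hp0 : 0 < p) (hp1 : p < 1) {n : ℕ} (hn : 2 ≤ n) :
    mahalanobis (covMat p n) (mean₀ p n) (mean₁ p n) = 2 / √(((n : ℝ) - 1) * p) := by
  have hn1 : 0 < (n : ℝ) - 1 := sub_pos.2 (by exact_mod_cast hn)
  have hdiff : (mean₁ p n - mean₀ p n).ofLp = ![-1, 1] := by
    ext j
    fin_cases j <;> simp [mean₀, mean₁]
  have hdet := (isUnit_iff_isUnit_det _).1 (covMat_posDef hp0 hp1 hn).isUnit
  have hinv : (covMat p n)⁻¹ *ᵥ ![-1, 1] = (((n : ℝ) - 1) * p / 2)⁻¹ • ![-1, 1] := by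
    rw [eq_inv_smul_iff₀ (by positivity), ← mulVec_smul, ← covMat_mulVec, mulVec_mulVec,
      nonsing_inv_mul _ hdet, one_mulVec]
  have hnorm : (![-1, 1] : Fin 2 → ℝ) ⬝ᵥ ![-1, 1] = 2 := by
    simp [dotProduct, Fin.sum_univ_two, one_add_one_eq_two]
  have hvalue : (((n : ℝ) - 1) * p / 2)⁻¹ * 2 = 2 ^ 2 / (((n : ℝ) - 1) * p) := by
    field_simp
  rw [mahalanobis, hdiff, hinv, dotProduct_smul, hnorm, smul_eq_mul, hvalue,
    Real.sqrt_div (sq_nonneg 2), Real.sqrt_sq zero_le_two]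

end MultivariateGaussian

end ShuffleDP

end

theorem theorem2 (ε₀ : ℝ) (hε₀ : 0 < ε₀) :
    (∃ δ : ℕ → ℝ,
      δ =o[Filter.atTop] (fun n => ShuffleDP.gdpParam ε₀ n) ∧
      ∀ n : ℕ, 2 ≤ n →
        ∀ (D : Type u) (S : ℕ → Type v) [∀ i, MeasurableSpace (S i)]
          (R : (i : ℕ) → D → ProbabilityTheory.Kernel ((j : Fin i) → S j) (S i))
          [∀ i x, ProbabilityTheory.IsMarkovKernel (R i x)],
          ShuffleDP.IsLDPProcess ε₀ n R →
            ShuffleDP.IsGDPUpTo (ShuffleDP.shuffledLaw R n) (ShuffleDP.gdpParam ε₀ n) (δ n)) ∧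
    (∀ n : ℕ, 2 ≤ n →
      ShuffleDP.mahalanobis (ShuffleDP.covMat (Real.exp (-ε₀)) n)
          (ShuffleDP.mean₀ (Real.exp (-ε₀)) n) (ShuffleDP.mean₁ (Real.exp (-ε₀)) n)
        = 2 / Real.sqrt (((n : ℝ) - 1) * Real.exp (-ε₀)) ∧
      ∀ α ∈ Set.Icc (0 : ℝ) 1,
        ShuffleDP.tradeoff
            (ProbabilityTheory.multivariateGaussian (ShuffleDP.mean₀ (Real.exp (-ε₀)) n)
              (ShuffleDP.covMat (Real.exp (-ε₀)) n))
            (ProbabilityTheory.multivariateGaussian (ShuffleDP.mean₁ (Real.exp (-ε₀)) n)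
              (ShuffleDP.covMat (Real.exp (-ε₀)) n)) α
          = ShuffleDP.gaussianTradeoff (ShuffleDP.gdpParam ε₀ n) α) := by
  have hp0 := Real.exp_pos (-ε₀)
  have hp1 : Real.exp (-ε₀) < 1 := by simpa using hε₀
  constructor
  · let p : unitInterval := ⟨Real.exp (-ε₀), hp0.le, hp1.le⟩
    refine ⟨fun n => ShuffleDP.labelPowerError p (ShuffleDP.gdpParam ε₀ n) n,
      ShuffleDP.isLittleO_labelPowerError rfl, fun n _ D S _ R _ hR => ?_⟩
    exact ShuffleDP.isGDPUpTo_shuffledLaw (p := p) hp1 hR.ofReal_exp_neg_smul_le _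
  · intro n hn
    have hdist := ShuffleDP.mahalanobis_covMat hp0 hp1 hn
    refine ⟨hdist, fun α hα => ?_⟩
    rw [ShuffleDP.gdpParam_eq, ← hdist]
    exact ShuffleDP.tradeoff_multivariateGaussian_of_posDef (ShuffleDP.covMat_posDef hp0 hp1 hn)
      _ _ hα
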